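/- Let $M$ be a smooth $n$-dimensional manifold (Hausdorff, second countable, without boundary) and let $h,k\ge 0$ be integers. An $h$-dimensional distribution on $M$ is a smooth rank $h$ subbundle $H\subset TM$; near every point it is the kernel of a smooth, pointwise surjective $\mathbf{R}^{n-h}$-valued 1-form $\theta$. A linear subspace $S\subset H_m$ is isotropic if $d\theta|_{S}=0$, and regular if the linear map $H_m\to \mathrm{Hom}(S,\mathbf{R}^{n-h})$, $X\mapsto(\iota_X d\theta)|_S$, is onto (neither condition depends on the choice of $\theta$). (1) If an $h$-dimensional distribution $H$ on $M$ admits a regular isotropic subspace $S\subset H_m$ of dimension $k$ at some point $m\in M$, then $h-k\ge (n-h)k$. (2) Conversely, if $h-k\ge (n-h)k$, then a generic $h$-dimensional distribution $H$ on $M$ admits regular isotropic $k$-planes at almost every point. That is: in the space of all $h$-dimensional distributions on $M$, those $H$ for which the set of points $m\in M$ such that $H_m$ contains no $k$-dimensional regular isotropic subspace has measure zero form a residual set (a set containing a countable intersection of dense open sets), both for the weak (compact-open) and for the strong (Whitney) $C^\infty$ topology. -/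

import Mathlib

open scoped Manifold ContDiff Topology
open MeasureTheory

noncomputable section

/-- The exterior derivative `dθ` at `y` of a vector valued 1-form `θ` on `ℝⁿ`, as a bilinear map:
`dθ(u, v) = (∂_u θ)(v) - (∂_v θ)(u)`. -/
def oneFormDeriv {n p : ℕ}
    (θ : EuclideanSpace ℝ (Fin n) → EuclideanSpace ℝ (Fin n) →L[ℝ] EuclideanSpace ℝ (Fin p))
    (y : EuclideanSpace ℝ (Fin n)) :
    EuclideanSpace ℝ (Fin n) →L[ℝ] EuclideanSpace ℝ (Fin n) →L[ℝ] EuclideanSpace ℝ (Fin p) :=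
  fderiv ℝ θ y - (fderiv ℝ θ y).flip

/-- The bilinear map above is Mathlib's exterior derivative. -/
theorem oneFormDeriv_apply_eq_extDeriv {n p : ℕ}
    (θ : EuclideanSpace ℝ (Fin n) → EuclideanSpace ℝ (Fin n) →L[ℝ] EuclideanSpace ℝ (Fin p))
    (y : EuclideanSpace ℝ (Fin n)) (hθ : DifferentiableAt ℝ θ y)
    (u v : EuclideanSpace ℝ (Fin n)) :
    oneFormDeriv θ y u v =
      extDeriv (fun z => ContinuousAlternatingMap.ofSubsingleton ℝ (EuclideanSpace ℝ (Fin n))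
        (EuclideanSpace ℝ (Fin p)) (0 : Fin 1) (θ z)) y ![u, v] := by
  let L : (EuclideanSpace ℝ (Fin n) →L[ℝ] EuclideanSpace ℝ (Fin p)) →L[ℝ]
      (EuclideanSpace ℝ (Fin n) [⋀^Fin 1]→L[ℝ] EuclideanSpace ℝ (Fin p)) :=
    (ContinuousAlternatingMap.ofSubsingletonLIE (𝕜 := ℝ) (E := EuclideanSpace ℝ (Fin n))
      (F := EuclideanSpace ℝ (Fin p)) (0 : Fin 1)).toContinuousLinearEquiv.toContinuousLinearMap
  have hd : DifferentiableAt ℝ (fun z => L (θ z)) y := L.differentiableAt.comp y hθ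
  change _ = extDeriv (fun z => L (θ z)) y ![u, v]
  have key : ∀ w : Fin 1 → EuclideanSpace ℝ (Fin n), ∀ a,
      fderiv ℝ (fun z => L (θ z) w) y a = fderiv ℝ θ y a (w 0) := by
    intro w a
    have h : (fun z => L (θ z) w) = fun z => θ z (w 0) := rfl
    rw [h, fderiv_clm_apply hθ (differentiableAt_const _)]
    simp
  rw [extDeriv_apply hd]
  simp [Fin.sum_univ_two, oneFormDeriv, Fin.removeNth, key, sub_eq_add_neg]

/-- The differential `T_x M → ℝⁿ` of a chart `φ` at `x`. -/
def chartDeriv {n : ℕ} {M : Type*} [TopologicalSpace M]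
    [ChartedSpace (EuclideanSpace ℝ (Fin n)) M]
    (φ : OpenPartialHomeomorph M (EuclideanSpace ℝ (Fin n))) (x : M) :
    TangentSpace (𝓡 n) x →L[ℝ] EuclideanSpace ℝ (Fin n) :=
  mfderiv (𝓡 n) (𝓡 n) φ x

/-- The value of `dθ` on tangent vectors of `M` at `x`, for a 1-form `θ` written in the
chart `φ`. -/
def tangentFormDeriv {n p : ℕ} {M : Type*} [TopologicalSpace M]
    [ChartedSpace (EuclideanSpace ℝ (Fin n)) M]
    (φ : OpenPartialHomeomorph M (EuclideanSpace ℝ (Fin n)))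
    (θ : EuclideanSpace ℝ (Fin n) → EuclideanSpace ℝ (Fin n) →L[ℝ] EuclideanSpace ℝ (Fin p))
    (x : M) :
    TangentSpace (𝓡 n) x →ₗ[ℝ] TangentSpace (𝓡 n) x →ₗ[ℝ] EuclideanSpace ℝ (Fin p) :=
  LinearMap.mk₂ ℝ (fun u v => oneFormDeriv θ (φ x) (chartDeriv φ x u) (chartDeriv φ x v))
    (by simp) (by simp) (by simp) (by simp)

/-- The expression in the chart `φ` of a field of tangent planes: the subspace of `ℝⁿ`
attached to the point `y` of the target of `φ`. -/
def chartPlane {n : ℕ} {M : Type*} [TopologicalSpace M]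
    [ChartedSpace (EuclideanSpace ℝ (Fin n)) M]
    (P : ∀ x : M, Submodule ℝ (TangentSpace (𝓡 n) x))
    (φ : OpenPartialHomeomorph M (EuclideanSpace ℝ (Fin n))) (y : EuclideanSpace ℝ (Fin n)) :
    Submodule ℝ (EuclideanSpace ℝ (Fin n)) :=
  (P (φ.symm y)).map (chartDeriv φ (φ.symm y)).toLinearMap

/-- `θ` is (the expression in the smooth chart `φ` of) a smooth `ℝᵖ`-valued 1-form defined near
`x`, everywhere onto, whose kernel is the plane field `P`. -/
structure IsLocalDefiningForm {n p : ℕ} {M : Type*} [TopologicalSpace M]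
    [ChartedSpace (EuclideanSpace ℝ (Fin n)) M]
    (P : ∀ x : M, Submodule ℝ (TangentSpace (𝓡 n) x)) (x : M)
    (φ : OpenPartialHomeomorph M (EuclideanSpace ℝ (Fin n)))
    (θ : EuclideanSpace ℝ (Fin n) → EuclideanSpace ℝ (Fin n) →L[ℝ] EuclideanSpace ℝ (Fin p)) :
    Prop where
  chart_mem : φ ∈ IsManifold.maximalAtlas (𝓡 n) ∞ M
  mem_source : x ∈ φ.source
  exists_nhds : ∃ U : Set (EuclideanSpace ℝ (Fin n)), IsOpen U ∧ φ x ∈ U ∧ U ⊆ φ.target ∧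
    ContDiffOn ℝ ∞ θ U ∧
    ∀ y ∈ U, Function.Surjective (θ y) ∧ (θ y).toLinearMap.ker = chartPlane P φ y

/-- A smooth `h`-dimensional distribution on the `n`-dimensional manifold `M`: a field of
`h`-dimensional tangent planes which, near each point, is the kernel of a smooth
`ℝⁿ⁻ʰ`-valued 1-form. -/
structure PlaneDistribution (n h : ℕ) (M : Type*) [TopologicalSpace M]
    [ChartedSpace (EuclideanSpace ℝ (Fin n)) M] where
  plane : ∀ x : M, Submodule ℝ (TangentSpace (𝓡 n) x)
  finrank_plane : ∀ x, Module.finrank ℝ (plane x) = h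
  smooth : ∀ x, ∃ (φ : OpenPartialHomeomorph M (EuclideanSpace ℝ (Fin n)))
    (θ : EuclideanSpace ℝ (Fin n) →
      EuclideanSpace ℝ (Fin n) →L[ℝ] EuclideanSpace ℝ (Fin (n - h))),
    IsLocalDefiningForm plane x φ θ

namespace PlaneDistribution

variable {n h : ℕ} {M : Type*} [TopologicalSpace M] [ChartedSpace (EuclideanSpace ℝ (Fin n)) M]

/-- `S ⊆ H_x` is a regular isotropic subspace. Here `H = ker θ` near `x`, with `θ` written in the
chart `φ`; `S` is isotropic if `dθ` vanishes on `S`, and regular if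
`H_x → Hom(S, ℝⁿ⁻ʰ)`, `X ↦ (ι_X dθ)|_S`, is onto.
These conditions do not depend on the choice of `φ` and `θ`, because another choice multiplies
`dθ` restricted to `H_x` by an invertible matrix. -/
def IsRegularIsotropic (H : PlaneDistribution n h M) (x : M)
    (S : Submodule ℝ (TangentSpace (𝓡 n) x)) : Prop :=
  S ≤ H.plane x ∧
  ∃ (φ : OpenPartialHomeomorph M (EuclideanSpace ℝ (Fin n)))
    (θ : EuclideanSpace ℝ (Fin n) →
      EuclideanSpace ℝ (Fin n) →L[ℝ] EuclideanSpace ℝ (Fin (n - h))),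
    IsLocalDefiningForm H.plane x φ θ ∧
    (∀ u ∈ S, ∀ v ∈ S, tangentFormDeriv φ θ x u v = 0) ∧
    Function.Surjective
      (fun X : H.plane x => ((tangentFormDeriv φ θ x X).domRestrict S :
        S →ₗ[ℝ] EuclideanSpace ℝ (Fin (n - h))))

/-- The distribution `H` admits a regular isotropic `k`-plane at the point `x`. -/
def HasRegularIsotropicPlane (H : PlaneDistribution n h M) (k : ℕ) (x : M) : Prop :=
  ∃ S : Submodule ℝ (TangentSpace (𝓡 n) x), Module.finrank ℝ S = k ∧ H.IsRegularIsotropic x S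

/-- The expression of `H` in the chart `φ`, as a matrix valued function on the target of `φ`: a
plane in `ℝⁿ` is represented by the orthogonal projection onto it. (This is the usual embedding
of the Grassmannian into a vector space.) -/
def chartProj (H : PlaneDistribution n h M)
    (φ : OpenPartialHomeomorph M (EuclideanSpace ℝ (Fin n))) (y : EuclideanSpace ℝ (Fin n)) :
    EuclideanSpace ℝ (Fin n) →L[ℝ] EuclideanSpace ℝ (Fin n) :=
  (chartPlane H.plane φ y).starProjection

/-- The distributions that are `ε`-close to `H` on `K`, together with their derivatives of
order at most `r`, in the chart `φ`. -/
def chartBall (H : PlaneDistribution n h M)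
    (φ : OpenPartialHomeomorph M (EuclideanSpace ℝ (Fin n))) (K : Set M) (r : ℕ) (ε : ℝ) :
    Set (PlaneDistribution n h M) :=
  {H' | ∀ s ≤ r, ∀ x ∈ K,
    ‖iteratedFDeriv ℝ s (H'.chartProj φ) (φ x) - iteratedFDeriv ℝ s (H.chartProj φ) (φ x)‖ < ε}

variable (n h M)

/-- The weak (compact-open) `C^∞` topology on the space of distributions: uniform
convergence of all derivatives on compact subsets of charts. -/
abbrev weakTopology : TopologicalSpace (PlaneDistribution n h M) :=
  TopologicalSpace.generateFrom
    {U | ∃ (H : PlaneDistribution n h M)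
      (φ : OpenPartialHomeomorph M (EuclideanSpace ℝ (Fin n))) (K : Set M) (r : ℕ) (ε : ℝ),
      φ ∈ IsManifold.maximalAtlas (𝓡 n) ∞ M ∧ IsCompact K ∧ K ⊆ φ.source ∧ 0 < ε ∧
      U = H.chartBall φ K r ε}

/-- The strong (Whitney) `C^∞` topology on the space of distributions: basic
neighbourhoods control, for some order `r`, the derivatives of order at most `r` on a locally
finite family of compact subsets `K i` of charts `φ i`, each up to its own `ε i > 0`. (On a second
countable manifold locally finite families of compact sets are countable.) -/
abbrev strongTopology : TopologicalSpace (PlaneDistribution n h M) :=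
  TopologicalSpace.generateFrom
    {U | ∃ (H : PlaneDistribution n h M)
      (φ : ℕ → OpenPartialHomeomorph M (EuclideanSpace ℝ (Fin n))) (K : ℕ → Set M) (r : ℕ)
      (ε : ℕ → ℝ),
      (∀ i, φ i ∈ IsManifold.maximalAtlas (𝓡 n) ∞ M) ∧ (∀ i, IsCompact (K i)) ∧
      (∀ i, K i ⊆ (φ i).source) ∧ LocallyFinite K ∧ (∀ i, 0 < ε i) ∧
      U = ⋂ i, H.chartBall (φ i) (K i) r (ε i)}

variable {n h M}

/-- A property of `h`-dimensional distributions on `M` is generic if it holds on a residual set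
(a set containing a countable intersection of dense open sets) of distributions, both for the weak
and for the strong `C^∞` topology. The two topologies agree if `M` is compact. -/
def IsGeneric (p : PlaneDistribution n h M → Prop) : Prop :=
  {H | p H} ∈ @residual (PlaneDistribution n h M) (weakTopology n h M) ∧
  {H | p H} ∈ @residual (PlaneDistribution n h M) (strongTopology n h M)

end PlaneDistribution

/-- The property `p` holds at almost every point of the manifold `M`: in every smooth chart, the
points where it fails form a Lebesgue null set. -/
def HoldsAlmostEverywhere (n : ℕ) {M : Type*} [TopologicalSpace M]
    [ChartedSpace (EuclideanSpace ℝ (Fin n)) M] (p : M → Prop) : Prop :=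
  ∀ φ ∈ IsManifold.maximalAtlas (𝓡 n) ∞ M, volume (φ '' {x ∈ φ.source | ¬ p x}) = 0

end

open scoped Manifold ContDiff Topology
open MeasureTheory

noncomputable section

/-! Necessity: X ↦ (ι_X dθ)|_S maps H_m onto a space of dimension (n-h)k, and isotropy puts S in its
kernel, so h ≥ (n-h)k + k (`HasRegularIsotropicPlane.dim_le`).

Genericity: the inequality leaves room in the kernel of an onto map A for a k-plane S and (n-h)k
further vectors, so some derivative D makes S regular isotropic for the 1-jet (A, D). Starting from
this model, Cramer's rule yields isotropic vectors for every 1-jet, and a product of determinants is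
an analytic function Q of the jet whose non-vanishing certifies a regular isotropic k-plane
(`exists_certificate`).

Given H = ker θ near a point, let θ₁ have the jet (A, D) there and perturb θ to θ + tβ(θ₁ - θ) with
a bump function β. Where β = 1 the jet is affine in t, and Q ≠ 0 at t = 1, so for each y the bad
values of t are the zeros of a nonzero analytic function of one variable. By Fubini, for almost
every t, hence for arbitrarily small ones, Q ≠ 0 at almost every y
(`ae_volume_setOf_analytic_eq_zero`). The perturbation is compactly supported, hence small even in
the strong topology.

On a compact set that misses measure less than ε of the ball, Q ≠ 0 survives C¹-small changes, a
weakly open condition (`exists_isOpen_volume_badSet_lt`). Countably many balls and values of ε then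
give a residual set. Density holds in the finer topology and openness in the coarser one, so both
topologies are treated at once. -/

/-- 1-jets `(θ, Dθ)` of `ℝᵖ`-valued 1-forms on a vector space. -/
abbrev FormJet (E : Type*) [NormedAddCommGroup E] [NormedSpace ℝ E] (p : ℕ) :=
  (E →L[ℝ] EuclideanSpace ℝ (Fin p)) × (E →L[ℝ] E →L[ℝ] EuclideanSpace ℝ (Fin p))

/-! ### Linear algebra of 1-jets: analytic certificates for regular isotropic planes. -/

section Jets

variable {E : Type*} [NormedAddCommGroup E] [NormedSpace ℝ E] {p : ℕ}

/-- The antisymmetrized derivative `dθ` of a 1-jet `(θ, Dθ)` of a vector valued 1-form. -/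
def jetCurvature (J : FormJet E p) :
    E →L[ℝ] E →L[ℝ] EuclideanSpace ℝ (Fin p) :=
  J.2 - J.2.flip

/-- The 1-jet `(θ, Dθ)` is onto and its kernel contains a `k`-dimensional regular isotropic
subspace, given by a basis. -/
def IsRegularIsotropicJet (k : ℕ) (J : FormJet E p) : Prop :=
  Function.Surjective J.1 ∧ ∃ v : Fin k → E, LinearIndependent ℝ v ∧ (∀ i, J.1 (v i) = 0) ∧
    (∀ i j, jetCurvature J (v i) (v j) = 0) ∧
    ∀ g : Fin k → EuclideanSpace ℝ (Fin p), ∃ X, J.1 X = 0 ∧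
      ∀ i, jetCurvature J (v i) X = g i

/-- A real analytic function on 1-jets whose non-vanishing ensures the existence of a
regular isotropic `k`-plane. -/
def IsJetCertificate (k : ℕ) (Q : FormJet E p → ℝ) : Prop :=
  ContDiff ℝ ω Q ∧ ∀ J, Q J ≠ 0 → IsRegularIsotropicJet k J

theorem contDiff_matrix_det {X ι : Type*} [NormedAddCommGroup X] [NormedSpace ℝ X] [Fintype ι]
    [DecidableEq ι] {r : WithTop ℕ∞} {A : X → Matrix ι ι ℝ}
    (hA : ∀ i j, ContDiff ℝ r fun x => A x i j) : ContDiff ℝ r fun x => (A x).det := by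
  simp only [Matrix.det_apply']
  exact ContDiff.sum fun σ _ => contDiff_const.mul (contDiff_prod fun i _ => hA _ _)

theorem contDiff_matrix_adjugate {X ι : Type*} [NormedAddCommGroup X] [NormedSpace ℝ X] [Fintype ι]
    [DecidableEq ι] {r : WithTop ℕ∞} {A : X → Matrix ι ι ℝ}
    (hA : ∀ i j, ContDiff ℝ r fun x => A x i j) (i j : ι) :
    ContDiff ℝ r fun x => (A x).adjugate i j := by
  simp only [Matrix.adjugate_apply]
  refine contDiff_matrix_det fun a b => ?_
  by_cases h : a = j
  · subst h; simpa using contDiff_const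
  · simpa [Matrix.updateRow_ne h] using hA a b

/-- The family `θ, dθ(v₀, ·), dθ(v₁, ·), …` attached to vectors depending on the jet. -/
def jetRow {i : ℕ} (v : Fin i → FormJet E p → E) (c : Fin (i + 1))
    (J : FormJet E p) :
    E →L[ℝ] EuclideanSpace ℝ (Fin p) :=
  Fin.cons (α := fun _ => E →L[ℝ] EuclideanSpace ℝ (Fin p)) J.1
    (fun j => jetCurvature J (v j J)) c

/-- The coordinates of `jetRow v` on the vectors `f c a`. -/
def jetMatrix {i : ℕ} (v : Fin i → FormJet E p → E) (f : ℕ → Fin p → E)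
    (J : FormJet E p) :
    Matrix (Fin (i + 1) × Fin p) (Fin (i + 1) × Fin p) ℝ :=
  Matrix.of fun r s => jetRow v r.1 J (f s.1 s.2) r.2

theorem contDiff_jetRow {i : ℕ} {v : Fin i → FormJet E p → E} {r : WithTop ℕ∞}
    (hv : ∀ j, ContDiff ℝ r (v j)) (c : Fin (i + 1)) (x : E) (a : Fin p) :
    ContDiff ℝ r fun J => jetRow v c J x a := by
  suffices h : ContDiff ℝ r fun J => jetRow v c J x from
    (EuclideanSpace.proj (𝕜 := ℝ) a).contDiff.comp h
  induction c using Fin.cases with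
  | zero => simpa [jetRow] using contDiff_fst.clm_apply contDiff_const
  | succ j =>
    simp only [jetRow, Fin.cons_succ, jetCurvature, sub_apply,
      ContinuousLinearMap.flip_apply]
    exact ((contDiff_snd.clm_apply (hv j)).clm_apply contDiff_const).sub
      ((contDiff_snd.clm_apply contDiff_const).clm_apply (hv j))

/-- A reference jet for which `e 0, …, e (k-1)` spans a regular isotropic subspace, regularity
being visible on the vectors `f c a`. -/
structure IsModelJet (k : ℕ) (e : ℕ → E) (f : ℕ → Fin p → E)
    (J : FormJet E p) :
    Prop where
  form_e : ∀ j < k, J.1 (e j) = 0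
  form_f : ∀ c ≤ k, ∀ a, J.1 (f c a) = if c = 0 then EuclideanSpace.single a 1 else 0
  curv_ee : ∀ i < k, ∀ j < k, jetCurvature J (e i) (e j) = 0
  curv_ef : ∀ j < k, ∀ c ≤ k, ∀ a,
    jetCurvature J (e j) (f c a) = if c = j + 1 then EuclideanSpace.single a 1 else 0

/-- The vectors f c a are dual to the rows of the linear system, so the determinants in Cramer's
rule equal 1 at the model jet. -/
theorem IsModelJet.jetMatrix_eq_one {k : ℕ} {e : ℕ → E} {f : ℕ → Fin p → E}
    {J : FormJet E p}
    (hJ : IsModelJet k e f J) {i : ℕ} (hi : i ≤ k)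
    {v : Fin i → FormJet E p → E} (hv : ∀ j, v j J = e j) :
    jetMatrix v f J = 1 := by
  ext ⟨c, a⟩ ⟨d, b⟩
  have hd : (d : ℕ) ≤ k := by omega
  induction c using Fin.cases with
  | zero =>
    simp only [jetMatrix, jetRow, Matrix.of_apply, Fin.cons_zero, hJ.form_f _ hd, Matrix.one_apply,
      Prod.mk.injEq]
    by_cases h : d = 0
    · subst h; simp
    · have h' : (d : ℕ) ≠ 0 := fun h' => h (Fin.ext h')
      simp [h', Ne.symm h]
  | succ j =>
    simp only [jetMatrix, jetRow, Matrix.of_apply, Fin.cons_succ, hv,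
      hJ.curv_ef j (by omega) _ hd, Matrix.one_apply, Prod.mk.injEq]
    by_cases h : j.succ = d
    · subst h; simp
    · have h' : (d : ℕ) ≠ j + 1 := fun h' => h (Fin.ext (by simp [h']))
      simp [h', h]

theorem jetCurvature_swap (J : FormJet E p) (u v : E) :
    jetCurvature J u v = -jetCurvature J v u := by
  simp [jetCurvature]

/-- Isotropic vectors depending analytically on the jet, by Cramer's rule. -/
theorem IsModelJet.exists_isotropic_frame {k : ℕ} {e : ℕ → E} {f : ℕ → Fin p → E}
    {J₀ : FormJet E p}
    (hJ : IsModelJet k e f J₀) (i : ℕ) (hi : i ≤ k) :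
    ∃ v : Fin i → FormJet E p → E,
      (∀ j, ContDiff ℝ ω (v j)) ∧ (∀ j (J : FormJet E p), J.1 (v j J) = 0) ∧
      (∀ j l J, jetCurvature J (v j J) (v l J) = 0) ∧ ∀ j, v j J₀ = e j := by
  induction i with
  | zero =>
    exact ⟨fun j => j.elim0, fun j => j.elim0, fun j => j.elim0, fun j => j.elim0,
      fun j => j.elim0⟩
  | succ i ih =>
    obtain ⟨v, hvω, hvθ, hvv, hv₀⟩ := ih (by omega)
    let b : FormJet E p →
        Fin (i + 1) × Fin p → ℝ := fun J r => jetRow v r.1 J (e i) r.2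
    -- Cramer's rule multiplied through by the determinant: nothing is inverted, so w is analytic on
    -- all jets, and M * adj M = det M makes every row vanish on w even where M is singular. Row 0
    -- gives θ(w) = 0, the later rows give dθ(v j, w) = 0.
    let w : FormJet E p → E :=
      fun J => (jetMatrix v f J).det • e i -
        ∑ q, ((jetMatrix v f J).adjugate.mulVec (b J)) q • f q.1 q.2
    have hM : ∀ r s, ContDiff ℝ ω fun J => jetMatrix v f J r s := fun r s => by
      simpa [jetMatrix] using contDiff_jetRow hvω r.1 (f s.1 s.2) r.2
    have hb : ∀ r, ContDiff ℝ ω fun J => b J r := fun r => contDiff_jetRow hvω r.1 (e i) r.2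
    have hwω : ContDiff ℝ ω w := by
      refine ((contDiff_matrix_det hM).smul contDiff_const).sub (ContDiff.sum fun q _ => ?_)
      refine ContDiff.smul ?_ contDiff_const
      simp only [Matrix.mulVec, dotProduct]
      exact ContDiff.sum fun r _ => (contDiff_matrix_adjugate hM _ _).mul (hb r)
    have hrow : ∀ c J, jetRow v c J (w J) = 0 := by
      intro c J
      ext a
      have h1 : jetRow v c J (w J) a = (jetMatrix v f J).det * b J (c, a) -
          ((jetMatrix v f J).mulVec ((jetMatrix v f J).adjugate.mulVec (b J))) (c, a) := by
        simp only [w, map_sub, map_sum, map_smul, PiLp.sub_apply, PiLp.smul_apply, smul_eq_mul]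
        congr 1
        rw [Matrix.mulVec, dotProduct, WithLp.ofLp_sum, Finset.sum_apply]
        exact Finset.sum_congr rfl fun q _ => by simp [jetMatrix, mul_comm]
      rw [h1, Matrix.mulVec_mulVec, Matrix.mul_adjugate]
      simp [Matrix.smul_mulVec]
    have hwθ : ∀ J : FormJet E p, J.1 (w J) = 0 := fun J => by simpa [jetRow] using hrow 0 J
    have hvw : ∀ j J, jetCurvature J (v j J) (w J) = 0 := fun j J => by
      simpa [jetRow] using hrow j.succ J
    -- At the model jet e i already solves the system, so no correction occurs and w starts at e i.
    have hb₀ : b J₀ = 0 := by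
      ext ⟨c, a⟩
      induction c using Fin.cases with
      | zero => simp [b, jetRow, hJ.form_e i (by omega)]
      | succ j => simp [b, jetRow, hv₀, hJ.curv_ee j (by omega) i (by omega)]
    have hw₀ : w J₀ = e i := by
      simp [w, hJ.jetMatrix_eq_one (by omega) hv₀, hb₀]
    refine ⟨Fin.snoc v w, fun j => ?_, fun j J => ?_, fun j l J => ?_, fun j => ?_⟩
    · induction j using Fin.lastCases <;> simp [hwω, hvω]
    · induction j using Fin.lastCases <;> simp [hwθ, hvθ]
    · induction j using Fin.lastCases <;> induction l using Fin.lastCases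
      · simp [jetCurvature]
      · rw [jetCurvature_swap]; simp [hvw]
      · simp [hvw]
      · simp [hvv]
    · induction j using Fin.lastCases <;> simp [hw₀, hv₀]

/-- The first determinant makes θ and all the dθ(v j, ·) jointly onto, which contains both
surjectivity of θ and regularity; the second, built from functionals dual to e, makes the v j
independent. Both matrices are the identity at the model jet. -/
theorem IsModelJet.exists_certificate {k : ℕ} {e : ℕ → E} {f : ℕ → Fin p → E}
    {J₀ : FormJet E p}
    (hJ : IsModelJet k e f J₀) (π : Fin k → E →L[ℝ] ℝ)
    (hπ : ∀ i j : Fin k, π i (e j) = if i = j then 1 else 0) :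
    ∃ Q, IsJetCertificate k Q ∧ Q J₀ ≠ 0 := by
  obtain ⟨v, hvω, hvθ, hvv, hv₀⟩ := hJ.exists_isotropic_frame k le_rfl
  have hM : ∀ r s, ContDiff ℝ ω fun J => jetMatrix v f J r s := fun r s => by
    simpa [jetMatrix] using contDiff_jetRow hvω r.1 (f s.1 s.2) r.2
  refine ⟨fun J => (jetMatrix v f J).det * (Matrix.of fun j i => π i (v j J)).det,
    ⟨(contDiff_matrix_det hM).mul (contDiff_matrix_det fun j i => ?_), fun J hQ => ?_⟩, ?_⟩
  · exact (π i).contDiff.comp (hvω j)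
  · obtain ⟨h1, h2⟩ := mul_ne_zero_iff.1 hQ
    have key : ∀ g : Fin (k + 1) → EuclideanSpace ℝ (Fin p), ∃ X, ∀ c, jetRow v c J X = g c := by
      intro g
      let b : Fin (k + 1) × Fin p → ℝ := fun r => g r.1 r.2
      refine ⟨∑ q, ((jetMatrix v f J)⁻¹.mulVec b) q • f q.1 q.2, fun c => ?_⟩
      ext a
      have h3 : ((jetMatrix v f J).mulVec ((jetMatrix v f J)⁻¹.mulVec b)) (c, a) = g c a := by
        rw [Matrix.mulVec_mulVec, Matrix.mul_nonsing_inv _ (isUnit_iff_ne_zero.2 h1)]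
        simp [b]
      rw [← h3]
      simp only [map_sum, map_smul]
      rw [Matrix.mulVec, dotProduct, WithLp.ofLp_sum, Finset.sum_apply]
      exact Finset.sum_congr rfl fun q _ => by simp [jetMatrix, mul_comm]
    refine ⟨fun y => ?_, fun j => v j J, ?_, fun j => hvθ j J, fun i j => hvv i j J, fun g => ?_⟩
    · obtain ⟨X, hX⟩ := key fun _ => y
      exact ⟨X, by simpa [jetRow] using hX 0⟩
    · have h3 := Matrix.linearIndependent_rows_of_det_ne_zero h2
      exact LinearIndependent.of_comp (LinearMap.pi fun i => (π i).toLinearMap) h3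
    -- Prescribing 0 in row 0 keeps X inside the kernel of θ.
    · obtain ⟨X, hX⟩ := key (Fin.cons 0 g)
      exact ⟨X, by simpa [jetRow] using hX 0, fun i => by simpa [jetRow] using hX i.succ⟩
  · have h4 : (Matrix.of fun j i => π i (v j J₀)) = (1 : Matrix (Fin k) (Fin k) ℝ) := by
      ext i j
      simp [hv₀, hπ, Matrix.one_apply, eq_comm]
    simp [hJ.jetMatrix_eq_one le_rfl hv₀, h4]

/-- Every onto map is the value of a 1-form with a regular isotropic subspace of any
admissible dimension, as detected by an analytic certificate. -/
theorem exists_certificate [FiniteDimensional ℝ E] {k : ℕ}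
    (A : E →L[ℝ] EuclideanSpace ℝ (Fin p)) (hA : Function.Surjective A)
    (hk : k + p * k ≤ Module.finrank ℝ A.toLinearMap.ker) :
    ∃ (D : E →L[ℝ] E →L[ℝ] EuclideanSpace ℝ (Fin p)) (Q : _ → ℝ),
      IsJetCertificate k Q ∧ Q (A, D) ≠ 0 := by
  let B := Module.finBasis ℝ A.toLinearMap.ker
  -- The dimension hypothesis enters here: k basis vectors of the kernel will span S, and p * k
  -- others will realise Hom(S, ℝᵖ).
  obtain ⟨emb⟩ : Nonempty (Fin k ⊕ Fin k × Fin p ↪ Fin (Module.finrank ℝ A.toLinearMap.ker)) := by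
    apply Function.Embedding.nonempty_of_card_le
    simpa [mul_comm] using hk
  let u : Fin k ⊕ Fin k × Fin p → E := fun s => B (emb s)
  obtain ⟨P, hP⟩ := A.toLinearMap.ker.exists_isCompl
  let pr : E →ₗ[ℝ] A.toLinearMap.ker := A.toLinearMap.ker.projectionOnto P hP
  let d : Fin k ⊕ Fin k × Fin p → E →L[ℝ] ℝ := fun s =>
    LinearMap.toContinuousLinearMap (B.coord (emb s) ∘ₗ pr)
  have hpr : ∀ x : A.toLinearMap.ker, pr x = x := fun x => by
    simp [pr]
  have hdu : ∀ s t, d s (u t) = if s = t then 1 else 0 := by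
    intro s t
    simp only [d, u, LinearMap.coe_toContinuousLinearMap', LinearMap.comp_apply, hpr]
    simp [Module.Basis.coord_apply, Finsupp.single_apply, eq_comm]
  have hAu : ∀ s, A (u s) = 0 := fun s => (B (emb s)).2
  choose g hg using hA
  -- Preimages under A are moved into the complement of the kernel, where all the functionals d
  -- vanish.
  let g' : EuclideanSpace ℝ (Fin p) → E := fun y => g y - pr (g y)
  have hg' : ∀ y, A (g' y) = y := fun y => by
    have : A (pr (g y)) = 0 := (pr (g y)).2
    simp [g', hg, this]
  have hdg : ∀ s y, d s (g' y) = 0 := fun s y => by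
    simp only [d, LinearMap.coe_toContinuousLinearMap', LinearMap.comp_apply, g', map_sub, hpr]
    simp
  let e : ℕ → E := fun j => if h : j < k then u (Sum.inl ⟨j, h⟩) else 0
  -- Index 0 is transverse to the kernel and index c + 1 is paired with e c, matching the rows of
  -- `jetRow`.
  let f : ℕ → Fin p → E := fun c a =>
    match c with
    | 0 => g' (EuclideanSpace.single a 1)
    | c + 1 => if h : c < k then u (Sum.inr (⟨c, h⟩, a)) else 0
  -- Each term is a product of a coordinate on S and a coordinate on the extra vectors, so dθ
  -- vanishes on S and pairs e c with f (c + 1) a to give the a-th basis vector.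
  let D : E →L[ℝ] E →L[ℝ] EuclideanSpace ℝ (Fin p) :=
    ∑ q : Fin k × Fin p, (d (Sum.inl q.1)).smulRight
      ((d (Sum.inr q)).smulRight (EuclideanSpace.single q.2 (1 : ℝ)))
  have hD : ∀ x y, D x y = ∑ q : Fin k × Fin p,
      (d (Sum.inl q.1) x * d (Sum.inr q) y) • EuclideanSpace.single q.2 (1 : ℝ) := by
    intro x y
    simp [D, mul_smul]
  have hmod : IsModelJet k e f (A, D) := by
    refine ⟨fun j hj => by simp [e, hj, hAu], fun c hc a => ?_, fun i hi j hj => ?_,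
      fun j hj c hc a => ?_⟩
    · cases c with
      | zero => simp [f, hg']
      | succ c => simp [f, show c < k by omega, hAu]
    · simp [jetCurvature, hD, e, hi, hj, hdu]
    · cases c with
      | zero => simp [jetCurvature, hD, e, f, hj, hdu, hdg]
      | succ c =>
        have hc' : c < k := by omega
        simp only [jetCurvature, sub_apply, ContinuousLinearMap.flip_apply, hD,
          e, f, hj, hc', dif_pos, hdu]
        simp only [reduceCtorEq, if_false, zero_mul, zero_smul, Finset.sum_const_zero, sub_zero,
          Sum.inl.injEq, Sum.inr.injEq]
        rw [Finset.sum_eq_single (⟨c, hc'⟩, a)]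
        · simp [Fin.ext_iff, eq_comm]
        · intro q _ hq
          simp [hq]
        · simp
  obtain ⟨Q, hQ, hQ'⟩ := hmod.exists_certificate (fun i => d (Sum.inl i)) (fun i j => by
    simp [e, hdu])
  exact ⟨D, Q, hQ, hQ'⟩

/-- If R is a right inverse of A, then A' ∘ R is close to the identity, hence invertible, for A'
near A. -/
theorem isOpen_setOf_clm_surjective [FiniteDimensional ℝ E] :
    IsOpen {A : E →L[ℝ] EuclideanSpace ℝ (Fin p) | Function.Surjective A} := by
  rw [isOpen_iff_mem_nhds]
  intro A hA
  obtain ⟨R, hR⟩ := LinearMap.exists_rightInverse_of_surjective A.toLinearMap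
    (LinearMap.range_eq_top.2 hA)
  let R' : EuclideanSpace ℝ (Fin p) →L[ℝ] E := LinearMap.toContinuousLinearMap R
  have h1 : Continuous fun A' : E →L[ℝ] EuclideanSpace ℝ (Fin p) => A'.comp R' := by fun_prop
  have h2 : A.comp R' = 1 := by
    ext1 x
    exact LinearMap.congr_fun hR x
  have h3 : ∀ᶠ A' in 𝓝 A, IsUnit (A'.comp R') :=
    h1.continuousAt.eventually (Units.isOpen.mem_nhds (by simp [h2]))
  filter_upwards [h3] with A' hA' y
  obtain ⟨B, hB⟩ := hA'.exists_right_inv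
  exact ⟨R' (B y), by simpa using DFunLike.congr_fun hB y⟩

end Jets

/-! ### Smooth dependence of the orthogonal projection onto a kernel. -/

section KernelProjection

variable {E G : Type*} [NormedAddCommGroup E] [InnerProductSpace ℝ E] [FiniteDimensional ℝ E]
  [NormedAddCommGroup G] [InnerProductSpace ℝ G] [FiniteDimensional ℝ G]

theorem contDiff_adjoint {r : WithTop ℕ∞} :
    ContDiff ℝ r fun A : E →L[ℝ] G => ContinuousLinearMap.adjoint A := by
  apply IsBoundedLinearMap.contDiff
  exact ⟨⟨fun x y => map_add _ x y, fun c x => by simp⟩, 1, one_pos, fun x => by simp⟩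

theorem isUnit_comp_adjoint {A : E →L[ℝ] G} (hA : Function.Surjective A) :
    IsUnit (A.comp (ContinuousLinearMap.adjoint A)) := by
  have hinj : Function.Injective (A.comp (ContinuousLinearMap.adjoint A)) := by
    rw [injective_iff_map_eq_zero]
    intro y hy
    have h1 : ContinuousLinearMap.adjoint A y = 0 := by
      rw [← inner_self_eq_zero (𝕜 := ℝ), ContinuousLinearMap.adjoint_inner_left]
      simp [show A (ContinuousLinearMap.adjoint A y) = 0 from hy]
    obtain ⟨x, rfl⟩ := hA y
    rw [← inner_self_eq_zero (𝕜 := ℝ), ← ContinuousLinearMap.adjoint_inner_right, h1,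
      inner_zero_right]
  rw [ContinuousLinearMap.isUnit_iff_bijective]
  exact ⟨hinj, (LinearMap.injective_iff_surjective
    (f := (A.comp (ContinuousLinearMap.adjoint A)).toLinearMap)).1 hinj⟩

/-- The closed formula 1 - A*(AA*)⁻¹A shows that the projection is a smooth function of A; AA* is
invertible because A is onto. -/
theorem starProjection_ker_eq {A : E →L[ℝ] G} (hA : Function.Surjective A) :
    A.toLinearMap.ker.starProjection = ContinuousLinearMap.id ℝ E -
      (ContinuousLinearMap.adjoint A).comp
        ((Ring.inverse (A.comp (ContinuousLinearMap.adjoint A))).comp A) := by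
  ext1 x
  have hu := isUnit_comp_adjoint hA
  have h1 : ∀ y, A (ContinuousLinearMap.adjoint A
      (Ring.inverse (A.comp (ContinuousLinearMap.adjoint A)) y)) = y := fun y => by
    have := DFunLike.congr_fun (Ring.mul_inverse_cancel _ hu) y
    simpa using this
  refine Submodule.eq_starProjection_of_mem_orthogonal ?_ ?_
  · simp [h1]
  · rw [Submodule.mem_orthogonal]
    intro u hu
    have hu' : A u = 0 := hu
    simp [ContinuousLinearMap.adjoint_inner_right, hu']

/-- The orthogonal projection onto the kernel depends smoothly on an onto linear map. -/
theorem contDiffAt_starProjection_ker {p : ℕ} {A : E →L[ℝ] EuclideanSpace ℝ (Fin p)}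
    (hA : Function.Surjective A) {r : WithTop ℕ∞} :
    ContDiffAt ℝ r (fun A : E →L[ℝ] EuclideanSpace ℝ (Fin p) =>
      A.toLinearMap.ker.starProjection) A := by
  have h1 : ContDiffAt ℝ r (fun A : E →L[ℝ] EuclideanSpace ℝ (Fin p) =>
      ContinuousLinearMap.id ℝ E - (ContinuousLinearMap.adjoint A).comp
        ((Ring.inverse (A.comp (ContinuousLinearMap.adjoint A))).comp A)) A := by
    obtain ⟨u, hu⟩ := isUnit_comp_adjoint hA
    have h2 : ContDiffAt ℝ r (fun A : E →L[ℝ] EuclideanSpace ℝ (Fin p) =>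
        Ring.inverse (A.comp (ContinuousLinearMap.adjoint A))) A := by
      refine ContDiffAt.comp A (g := Ring.inverse) ?_
        (contDiff_id.clm_comp contDiff_adjoint).contDiffAt
      simp only
      rw [← hu]
      exact contDiffAt_ringInverse ℝ u
    exact contDiffAt_const.sub (contDiff_adjoint.contDiffAt.clm_comp (h2.clm_comp contDiffAt_id))
  refine h1.congr_of_eventuallyEq ?_
  filter_upwards [isOpen_setOf_clm_surjective.mem_nhds hA] with A' hA'
  exact starProjection_ker_eq hA'

end KernelProjection

/-- The iterated derivatives of a smooth family of functions depend smoothly on the parameter. -/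
theorem contDiffAt_iteratedFDeriv_param {T E V : Type*} [NormedAddCommGroup T] [NormedSpace ℝ T]
    [NormedAddCommGroup E] [NormedSpace ℝ E] [NormedAddCommGroup V] [NormedSpace ℝ V]
    {F : T × E → V} {t₀ : T} {z₀ : E} (hF : ContDiffAt ℝ ∞ F (t₀, z₀)) (s : ℕ) :
    ContDiffAt ℝ ∞ (fun q : T × E => iteratedFDeriv ℝ s (fun z => F (q.1, z)) q.2) (t₀, z₀) := by
  induction s with
  | zero =>
    simp only [iteratedFDeriv_zero_eq_comp]
    exact (continuousMultilinearCurryFin0 ℝ E V).symm.contDiff.contDiffAt.comp _ hF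
  | succ s ih =>
    simp only [iteratedFDeriv_succ_eq_comp_left]
    have h : ContDiffAt ℝ ∞ (fun q : T × E =>
        fderiv ℝ (iteratedFDeriv ℝ s (fun z => F (q.1, z))) q.2) (t₀, z₀) := by
      -- Only z is differentiated: all of q, including the evaluation point q.2, is treated as a
      -- parameter.
      refine ContDiffAt.fderiv (n := ∞)
        (f := fun (q : T × E) z => iteratedFDeriv ℝ s (fun z => F (q.1, z)) z)
        (g := Prod.snd) ?_ contDiffAt_snd (by simp)
      exact ContDiffAt.comp (g := fun q : T × E => iteratedFDeriv ℝ s (fun z => F (q.1, z)) q.2)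
        (f := fun q : (T × E) × E => (q.1.1, q.2)) ((t₀, z₀), z₀) ih (by fun_prop)
    exact h.continuousLinearMap_comp
      ((continuousMultilinearCurryLeftEquiv ℝ (fun _ : Fin (s + 1) => E) V).symm :
        _ →L[ℝ] E [×(s + 1)]→L[ℝ] V)

/-! ### Plane fields in different charts. -/

section Charts

variable {n : ℕ} {M : Type*} [TopologicalSpace M] [ChartedSpace (EuclideanSpace ℝ (Fin n)) M]
  {φ ψ : OpenPartialHomeomorph M (EuclideanSpace ℝ (Fin n))}

theorem bijective_chartDeriv (hφ : φ ∈ IsManifold.maximalAtlas (𝓡 n) ∞ M) {x : M}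
    (hx : x ∈ φ.source) : Function.Bijective (chartDeriv φ x) := by
  have h : φ.MDifferentiable (𝓡 n) (𝓡 n) :=
    ⟨(contMDiffOn_of_mem_maximalAtlas hφ).mdifferentiableOn (by simp),
      (contMDiffOn_symm_of_mem_maximalAtlas hφ).mdifferentiableOn (by simp)⟩
  exact (h.mfderiv hx).bijective

theorem contDiffAt_chart_transition (hφ : φ ∈ IsManifold.maximalAtlas (𝓡 n) ∞ M)
    (hψ : ψ ∈ IsManifold.maximalAtlas (𝓡 n) ∞ M) {y : EuclideanSpace ℝ (Fin n)}
    (hy : y ∈ φ.target) (hy' : φ.symm y ∈ ψ.source) :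
    ContDiffAt ℝ ∞ (fun z => ψ (φ.symm z)) y := by
  rw [← contMDiffAt_iff_contDiffAt]
  exact (contMDiffAt_of_mem_maximalAtlas hψ hy').comp y (contMDiffAt_symm_of_mem_maximalAtlas hφ hy)

theorem chartDeriv_eq_fderiv_comp (hφ : φ ∈ IsManifold.maximalAtlas (𝓡 n) ∞ M)
    (hψ : ψ ∈ IsManifold.maximalAtlas (𝓡 n) ∞ M) {x : M} (hx : x ∈ φ.source)
    (hx' : x ∈ ψ.source) (u : TangentSpace (𝓡 n) x) :
    chartDeriv ψ x u = fderiv ℝ (fun z => ψ (φ.symm z)) (φ x) (chartDeriv φ x u) := by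
  have h1 : MDifferentiableAt (𝓡 n) (𝓡 n) (fun z => ψ (φ.symm z)) (φ x) :=
    ((contDiffAt_chart_transition hφ hψ (φ.map_source hx) (by rwa [φ.left_inv hx])).differentiableAt
      (by simp)).mdifferentiableAt
  have h2 : MDifferentiableAt (𝓡 n) (𝓡 n) φ x :=
    (contMDiffAt_of_mem_maximalAtlas hφ hx).mdifferentiableAt (by simp)
  have h3 : (fun z => ψ (φ.symm z)) ∘ φ =ᶠ[𝓝 x] ψ := by
    filter_upwards [φ.open_source.mem_nhds hx] with z hz
    simp [φ.left_inv hz]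
  have h4 := mfderiv_comp x h1 h2
  rw [h3.mfderiv_eq, mfderiv_eq_fderiv] at h4
  exact DFunLike.congr_fun h4 u

theorem chartPlane_apply (P : ∀ x : M, Submodule ℝ (TangentSpace (𝓡 n) x)) {x : M}
    (hx : x ∈ φ.source) :
    chartPlane P φ (φ x) = (P x).map (chartDeriv φ x).toLinearMap := by
  have : ∀ x', x' = x → (P x').map (chartDeriv φ x').toLinearMap =
      (P x).map (chartDeriv φ x).toLinearMap := by rintro _ rfl; rfl
  exact this _ (φ.left_inv hx)

theorem mem_chartPlane_iff (P : ∀ x : M, Submodule ℝ (TangentSpace (𝓡 n) x))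
    (hφ : φ ∈ IsManifold.maximalAtlas (𝓡 n) ∞ M) {x : M} (hx : x ∈ φ.source)
    (u : TangentSpace (𝓡 n) x) : chartDeriv φ x u ∈ chartPlane P φ (φ x) ↔ u ∈ P x := by
  rw [chartPlane_apply P hx]
  constructor
  · rintro ⟨v, hv, h⟩
    rwa [← (bijective_chartDeriv hφ hx).1 h]
  · exact fun h => ⟨u, h, rfl⟩

theorem chartPlane_eq_ker_comp (P : ∀ x : M, Submodule ℝ (TangentSpace (𝓡 n) x))
    (hφ : φ ∈ IsManifold.maximalAtlas (𝓡 n) ∞ M)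
    (hψ : ψ ∈ IsManifold.maximalAtlas (𝓡 n) ∞ M) {x : M} (hx : x ∈ φ.source)
    (hx' : x ∈ ψ.source) {p : ℕ}
    {A : EuclideanSpace ℝ (Fin n) →L[ℝ] EuclideanSpace ℝ (Fin p)}
    (hA : A.toLinearMap.ker = chartPlane P φ (φ x)) :
    chartPlane P ψ (ψ x) =
      (A.comp (fderiv ℝ (fun z => φ (ψ.symm z)) (ψ x))).toLinearMap.ker := by
  ext v
  obtain ⟨u, rfl⟩ := (bijective_chartDeriv hψ hx').2 v
  rw [mem_chartPlane_iff P hψ hx', ← mem_chartPlane_iff P hφ hx, ← hA,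
    chartDeriv_eq_fderiv_comp hψ hφ hx' hx]
  rfl

theorem surjective_fderiv_chart_transition (hφ : φ ∈ IsManifold.maximalAtlas (𝓡 n) ∞ M)
    (hψ : ψ ∈ IsManifold.maximalAtlas (𝓡 n) ∞ M) {x : M} (hx : x ∈ φ.source)
    (hx' : x ∈ ψ.source) :
    Function.Surjective (fderiv ℝ (fun z => φ (ψ.symm z)) (ψ x)) := by
  intro v
  obtain ⟨u, rfl⟩ := (bijective_chartDeriv hφ hx).2 v
  exact ⟨_, (chartDeriv_eq_fderiv_comp hψ hφ hx' hx u).symm⟩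

/-- The orthogonal projections representing a smooth family of plane fields depend smoothly on the
parameter and the point, in every chart. -/
theorem contDiffAt_starProjection_chartPlane {T : Type*} [NormedAddCommGroup T] [NormedSpace ℝ T]
    (P : T → ∀ x : M, Submodule ℝ (TangentSpace (𝓡 n) x))
    (hφ : φ ∈ IsManifold.maximalAtlas (𝓡 n) ∞ M)
    (hψ : ψ ∈ IsManifold.maximalAtlas (𝓡 n) ∞ M) {x : M} (hx : x ∈ φ.source)
    (hx' : x ∈ ψ.source) {t₀ : T} {p : ℕ}
    {θ : T × EuclideanSpace ℝ (Fin n) → EuclideanSpace ℝ (Fin n) →L[ℝ] EuclideanSpace ℝ (Fin p)}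
    (hθ : ContDiffAt ℝ ∞ θ (t₀, φ x))
    (hker : ∀ᶠ q in 𝓝 (t₀, φ x), Function.Surjective (θ q) ∧
      (θ q).toLinearMap.ker = chartPlane (P q.1) φ q.2) :
    ContDiffAt ℝ ∞ (fun q : T × EuclideanSpace ℝ (Fin n) =>
      (chartPlane (P q.1) ψ q.2).starProjection) (t₀, ψ x) := by
  have hsx : ψ.symm (ψ x) = x := ψ.left_inv hx'
  have hτ : ContDiffAt ℝ ∞ (fun z => φ (ψ.symm z)) (ψ x) :=
    contDiffAt_chart_transition hψ hφ (ψ.map_source hx') (by rwa [hsx])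
  have hτ' : ContDiffAt ℝ ∞ (fun q : T × EuclideanSpace ℝ (Fin n) => (q.1, φ (ψ.symm q.2)))
      (t₀, ψ x) := contDiffAt_fst.prodMk
    (ContDiffAt.comp (g := fun z => φ (ψ.symm z)) (t₀, ψ x) hτ contDiffAt_snd)
  have hB : ContDiffAt ℝ ∞ (fun q : T × EuclideanSpace ℝ (Fin n) =>
      (θ (q.1, φ (ψ.symm q.2))).comp (fderiv ℝ (fun z => φ (ψ.symm z)) q.2)) (t₀, ψ x) := by
    refine ContDiffAt.clm_comp (ContDiffAt.comp (t₀, ψ x) (by simpa [hsx] using hθ) hτ') ?_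
    exact ContDiffAt.comp (t₀, ψ x) (hτ.fderiv_right (m := ∞) (by simp)) contDiffAt_snd
  have hev : ∀ᶠ q : T × EuclideanSpace ℝ (Fin n) in 𝓝 (t₀, ψ x),
      q.2 ∈ ψ.target ∧ ψ.symm q.2 ∈ φ.source := by
    have h1 : ∀ᶠ z in 𝓝 (ψ x), z ∈ ψ.target ∧ ψ.symm z ∈ φ.source :=
      (ψ.open_target.eventually_mem (ψ.map_source hx')).and
        ((ψ.continuousAt_symm (ψ.map_source hx')).eventually
          (by rw [hsx]; exact φ.open_source.eventually_mem hx))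
    exact h1.prod_inr_nhds t₀
  have hker' : ∀ᶠ q : T × EuclideanSpace ℝ (Fin n) in 𝓝 (t₀, ψ x),
      Function.Surjective (θ (q.1, φ (ψ.symm q.2))) ∧
      (θ (q.1, φ (ψ.symm q.2))).toLinearMap.ker = chartPlane (P q.1) φ (φ (ψ.symm q.2)) := by
    rw [← hsx] at hker
    exact hτ'.continuousAt.eventually hker
  have hall : ∀ᶠ q : T × EuclideanSpace ℝ (Fin n) in 𝓝 (t₀, ψ x),
      Function.Surjective ((θ (q.1, φ (ψ.symm q.2))).comp
        (fderiv ℝ (fun z => φ (ψ.symm z)) q.2)) ∧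
      chartPlane (P q.1) ψ q.2 = ((θ (q.1, φ (ψ.symm q.2))).comp
        (fderiv ℝ (fun z => φ (ψ.symm z)) q.2)).toLinearMap.ker := by
    filter_upwards [hev, hker'] with q ⟨hq1, hq2⟩ ⟨hq3, hq4⟩
    have h5 : ψ (ψ.symm q.2) = q.2 := ψ.right_inv hq1
    have h6 := surjective_fderiv_chart_transition hφ hψ hq2 (ψ.map_target hq1)
    have h7 := chartPlane_eq_ker_comp (P q.1) hφ hψ hq2 (ψ.map_target hq1) hq4
    rw [h5] at h6 h7
    exact ⟨hq3.comp h6, h7⟩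
  refine ContDiffAt.congr_of_eventuallyEq
    (f := fun q => ((θ (q.1, φ (ψ.symm q.2))).comp
      (fderiv ℝ (fun z => φ (ψ.symm z)) q.2)).toLinearMap.ker.starProjection) ?_ ?_
  · exact ContDiffAt.comp (t₀, ψ x) (contDiffAt_starProjection_ker hall.self_of_nhds.1) hB
  · filter_upwards [hall] with q hq
    exact congrArg (fun V : Submodule ℝ (EuclideanSpace ℝ (Fin n)) => V.starProjection) hq.2

end Charts

/-! ### Distributions in charts, defining forms and the dimension bound. -/

namespace PlaneDistribution

variable {n h k : ℕ} {M : Type*} [TopologicalSpace M] [ChartedSpace (EuclideanSpace ℝ (Fin n)) M]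
  {φ ψ : OpenPartialHomeomorph M (EuclideanSpace ℝ (Fin n))}

theorem finrank_chartPlane (H : PlaneDistribution n h M)
    (hφ : φ ∈ IsManifold.maximalAtlas (𝓡 n) ∞ M) {y : EuclideanSpace ℝ (Fin n)}
    (hy : y ∈ φ.target) : Module.finrank ℝ (chartPlane H.plane φ y) = h := by
  exact (Submodule.equivMapOfInjective _
    (bijective_chartDeriv hφ (φ.map_target hy)).1 _).finrank_eq.symm.trans
      (H.finrank_plane (φ.symm y))

theorem le_dim (H : PlaneDistribution n h M) (x : M) : h ≤ n := by
  have h1 := H.finrank_plane x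
  have h2 : Module.finrank ℝ (TangentSpace (𝓡 n) x) = n :=
    finrank_euclideanSpace_fin (𝕜 := ℝ) (n := n)
  have : FiniteDimensional ℝ (TangentSpace (𝓡 n) x) :=
    inferInstanceAs (FiniteDimensional ℝ (EuclideanSpace ℝ (Fin n)))
  have h3 := Submodule.finrank_le (H.plane x)
  omega

theorem contDiffAt_chartProj (H : PlaneDistribution n h M)
    (hψ : ψ ∈ IsManifold.maximalAtlas (𝓡 n) ∞ M) {y : EuclideanSpace ℝ (Fin n)}
    (hy : y ∈ ψ.target) : ContDiffAt ℝ ∞ (H.chartProj ψ) y := by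
  obtain ⟨φ, θ, hφ, hx, U, hUo, hxU, -, hθ, hker⟩ := H.smooth (ψ.symm y)
  -- The lemma on families is applied to a constant family with a dummy real parameter; the defining
  -- form may live in a chart other than ψ.
  have h1 := contDiffAt_starProjection_chartPlane (T := ℝ) (t₀ := 0) (fun _ => H.plane) hφ hψ hx
    (ψ.map_target hy) (θ := fun q => θ q.2)
    (ContDiffAt.comp (g := θ) _ (hθ.contDiffAt (hUo.mem_nhds hxU)) contDiffAt_snd)
    (Filter.Eventually.prod_inr_nhds (p := fun y => Function.Surjective (θ y) ∧
      (θ y).toLinearMap.ker = chartPlane H.plane φ y) ((hUo.eventually_mem hxU).mono hker) 0)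
  rw [ψ.right_inv hy] at h1
  exact ContDiffAt.comp (f := fun z : EuclideanSpace ℝ (Fin n) => ((0 : ℝ), z)) y h1 (by fun_prop)

/-- A local defining form whose jet is regular isotropic yields a regular isotropic plane. -/
theorem hasRegularIsotropicPlane_of_jet {H : PlaneDistribution n h M} {x : M}
    {θ : EuclideanSpace ℝ (Fin n) →
      EuclideanSpace ℝ (Fin n) →L[ℝ] EuclideanSpace ℝ (Fin (n - h))}
    (hθ : IsLocalDefiningForm H.plane x φ θ)
    (hJ : IsRegularIsotropicJet k (θ (φ x), fderiv ℝ θ (φ x))) :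
    H.HasRegularIsotropicPlane k x := by
  obtain ⟨-, v, hv, hvθ, hvv, hreg⟩ := hJ
  obtain ⟨U, -, hxU, -, -, hker⟩ := hθ.exists_nhds
  have hbij := bijective_chartDeriv hθ.chart_mem hθ.mem_source
  have hmem : ∀ u, θ (φ x) (chartDeriv φ x u) = 0 → u ∈ H.plane x := fun u hu => by
    rw [← mem_chartPlane_iff H.plane hθ.chart_mem hθ.mem_source, ← (hker _ hxU).2]
    exact hu
  choose u hu using fun i => hbij.2 (v i)
  have hT : ∀ a b, tangentFormDeriv φ θ x a b =
      jetCurvature (θ (φ x), fderiv ℝ θ (φ x)) (chartDeriv φ x a) (chartDeriv φ x b) :=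
    fun a b => rfl
  have hui : LinearIndependent ℝ u := by
    have h1 : (chartDeriv φ x).toLinearMap ∘ u = v := funext hu
    exact LinearIndependent.of_comp (chartDeriv φ x).toLinearMap (h1 ▸ hv)
  refine ⟨Submodule.span ℝ (Set.range u), ?_, ?_, φ, θ, hθ, ?_, ?_⟩
  · rw [finrank_span_eq_card hui, Fintype.card_fin]
  · rw [Submodule.span_le]
    rintro _ ⟨i, rfl⟩
    exact hmem _ (by rw [hu, hvθ])
  · intro a ha b hb
    induction ha using Submodule.span_induction with
    | mem a ha =>
      obtain ⟨i, rfl⟩ := ha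
      induction hb using Submodule.span_induction with
      | mem b hb =>
        obtain ⟨j, rfl⟩ := hb
        rw [hT, hu, hu, hvv]
      | zero => simp
      | add b c _ _ hb hc => rw [map_add, hb, hc, add_zero]
      | smul r b _ hb => rw [map_smul, hb, smul_zero]
    | zero => simp
    | add b c _ _ hb hc => rw [map_add, LinearMap.add_apply, hb, hc, add_zero]
    | smul r b _ hb => rw [map_smul, LinearMap.smul_apply, hb, smul_zero]
  · intro l
    -- The sign accounts for the jet condition having X in the second slot of dθ and regularity
    -- having it in the first.
    obtain ⟨X, hX, hXv⟩ := hreg fun i => -l ⟨u i, Submodule.subset_span ⟨i, rfl⟩⟩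
    obtain ⟨Y, rfl⟩ := hbij.2 X
    refine ⟨⟨Y, hmem Y hX⟩, ?_⟩
    ext1 ⟨s, hs⟩
    change tangentFormDeriv φ θ x Y s = l ⟨s, hs⟩
    induction hs using Submodule.span_induction with
    | mem a ha =>
      obtain ⟨i, rfl⟩ := ha
      rw [hT, hu, jetCurvature_swap, hXv, neg_neg]
    | zero => rw [map_zero]; exact (map_zero l).symm
    | add b c hb hc hb' hc' =>
      rw [map_add, hb', hc', ← map_add]; rfl
    | smul r b hb hb' => rw [map_smul, hb', ← map_smul]; rfl

/-- Composing a form with the projection along a distribution gives a defining form, as long as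
it remains onto. -/
theorem isLocalDefiningForm_comp_proj (H : PlaneDistribution n h M)
    (hφ : φ ∈ IsManifold.maximalAtlas (𝓡 n) ∞ M) {x : M} (hx : x ∈ φ.source)
    {A : EuclideanSpace ℝ (Fin n) →
      EuclideanSpace ℝ (Fin n) →L[ℝ] EuclideanSpace ℝ (Fin (n - h))}
    {U : Set (EuclideanSpace ℝ (Fin n))} (hU : IsOpen U) (hxU : φ x ∈ U) (hUt : U ⊆ φ.target)
    (hA : ContDiffOn ℝ ∞ A U)
    (hsurj : Function.Surjective ((A (φ x)).comp
      (ContinuousLinearMap.id ℝ _ - H.chartProj φ (φ x)))) :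
    IsLocalDefiningForm H.plane x φ
      (fun y => (A y).comp (ContinuousLinearMap.id ℝ _ - H.chartProj φ y)) := by
  have hsm : ContDiffOn ℝ ∞ (fun y => (A y).comp
      (ContinuousLinearMap.id ℝ _ - H.chartProj φ y)) U :=
    hA.clm_comp (contDiffOn_const.sub fun y hy =>
      (H.contDiffAt_chartProj hφ (hUt hy)).contDiffWithinAt)
  refine ⟨hφ, hx, U ∩ (fun y => (A y).comp (ContinuousLinearMap.id ℝ _ - H.chartProj φ y)) ⁻¹'
    {B | Function.Surjective B}, hsm.continuousOn.isOpen_inter_preimage hU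
      isOpen_setOf_clm_surjective, ⟨hxU, hsurj⟩, fun y hy => hUt hy.1,
      hsm.mono Set.inter_subset_left, fun y hy => ⟨hy.2, ?_⟩⟩
  -- The plane is fixed by its projection, so it lies in the kernel; since the form is onto, both
  -- have dimension n - (n - h) = h.
  have hle : chartPlane H.plane φ y ≤ ((A y).comp
      (ContinuousLinearMap.id ℝ _ - H.chartProj φ y)).toLinearMap.ker := by
    intro v hv
    have : H.chartProj φ y v = v := Submodule.starProjection_eq_self_iff.2 hv
    simp [this]
  refine (Submodule.eq_of_le_of_finrank_eq hle ?_).symm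
  have h1 := LinearMap.finrank_range_add_finrank_ker ((A y).comp
      (ContinuousLinearMap.id ℝ _ - H.chartProj φ y)).toLinearMap
  rw [LinearMap.range_eq_top.2 hy.2, finrank_top] at h1
  simp only [finrank_euclideanSpace, Fintype.card_fin] at h1
  have h2 := H.le_dim x
  rw [H.finrank_chartPlane hφ (hUt hy.1)]
  omega

/-- The dimension bound for regular isotropic planes. -/
theorem HasRegularIsotropicPlane.dim_le {H : PlaneDistribution n h M} {x : M}
    (hx : H.HasRegularIsotropicPlane k x) : k + (n - h) * k ≤ h := by
  obtain ⟨S, hSk, hSH, φ, θ, -, hiso, hsurj⟩ := hx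
  have : FiniteDimensional ℝ (TangentSpace (𝓡 n) x) :=
    inferInstanceAs (FiniteDimensional ℝ (EuclideanSpace ℝ (Fin n)))
  let L : H.plane x →ₗ[ℝ] S →ₗ[ℝ] EuclideanSpace ℝ (Fin (n - h)) :=
    { toFun := fun X => (tangentFormDeriv φ θ x X).domRestrict S
      map_add' := fun X Y => by ext1 s; simp
      map_smul' := fun c X => by ext1 s; simp }
  have h1 := LinearMap.finrank_range_add_finrank_ker L
  rw [LinearMap.range_eq_top.2 hsurj, finrank_top, Module.finrank_linearMap, hSk, H.finrank_plane,
    finrank_euclideanSpace, Fintype.card_fin] at h1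
  have h2 : Module.finrank ℝ (S.submoduleOf (H.plane x)) = k := by
    rw [← hSk]
    exact (Submodule.submoduleOfEquivOfLe hSH).finrank_eq
  -- Isotropy contributes k to the kernel of L, beyond the rank (n - h) * k.
  have h3 : S.submoduleOf (H.plane x) ≤ L.ker := by
    intro X hX
    ext1 s
    exact hiso X hX s s.2
  have h4 := Submodule.finrank_mono h3
  nlinarith

end PlaneDistribution

/-! ### Convergence in the strong topology and comparison with the weak one. -/

namespace PlaneDistribution

variable {n h k : ℕ} {M : Type*} [TopologicalSpace M] [ChartedSpace (EuclideanSpace ℝ (Fin n)) M]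
  {φ ψ : OpenPartialHomeomorph M (EuclideanSpace ℝ (Fin n))}

/-- A smooth one parameter family of distributions which is constant outside a compact set is
continuous for the strong topology. -/
theorem tendsto_strongTopology [T2Space M] {H : PlaneDistribution n h M}
    {Ht : ℝ → PlaneDistribution n h M} {P : ℝ → ∀ x : M, Submodule ℝ (TangentSpace (𝓡 n) x)}
    (hP : P 0 = H.plane) (hHt : ∀ᶠ t in 𝓝 0, (Ht t).plane = P t) {C : Set M} (hC : IsCompact C)
    (hPC : ∀ t, ∀ x ∉ C, P t x = H.plane x)
    (hsm : ∀ ψ ∈ IsManifold.maximalAtlas (𝓡 n) ∞ M, ∀ x ∈ ψ.source,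
      ContDiffAt ℝ ∞ (fun q : ℝ × EuclideanSpace ℝ (Fin n) =>
        (chartPlane (P q.1) ψ q.2).starProjection) (0, ψ x)) :
    Filter.Tendsto Ht (𝓝 0) (@nhds _ (strongTopology n h M) H) := by
  rw [TopologicalSpace.tendsto_nhds_generateFrom_iff]
  rintro _ ⟨H₀, φ, K, r, ε, hφ, hK, hKφ, hloc, hε, rfl⟩ hH
  rw [Set.mem_iInter] at hH
  have hproj : ∀ ψ : OpenPartialHomeomorph M (EuclideanSpace ℝ (Fin n)),
      (fun z => (chartPlane (P 0) ψ z).starProjection) = H.chartProj ψ := by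
    intro ψ
    rw [hP]
    rfl
  have hnear : ∀ i, ∀ s ≤ r, ∀ᶠ t in 𝓝 (0 : ℝ), ∀ x ∈ K i,
      ‖iteratedFDeriv ℝ s (fun z => (chartPlane (P t) (φ i) z).starProjection) (φ i x) -
        iteratedFDeriv ℝ s (H₀.chartProj (φ i)) (φ i x)‖ < ε i := by
    intro i s hs
    -- Joint continuity in (t, x) and compactness of K i give one range of t for all x in K i.
    refine (hK i).eventually_forall_of_forall_eventually fun x hx => ?_
    have hxs := hKφ i hx
    have h1 : ContinuousAt (fun q : ℝ × EuclideanSpace ℝ (Fin n) =>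
        iteratedFDeriv ℝ s (fun z => (chartPlane (P q.1) (φ i) z).starProjection) q.2)
        (0, φ i x) :=
      (contDiffAt_iteratedFDeriv_param (hsm _ (hφ i) x hxs) s).continuousAt
    have h2 : ContinuousAt (fun q : ℝ × EuclideanSpace ℝ (Fin n) =>
        iteratedFDeriv ℝ s (H₀.chartProj (φ i)) q.2) (0, φ i x) :=
      (contDiffAt_iteratedFDeriv_param (F := fun q : ℝ × EuclideanSpace ℝ (Fin n) =>
        H₀.chartProj (φ i) q.2) (ContDiffAt.comp (g := H₀.chartProj (φ i)) _
          (H₀.contDiffAt_chartProj (hφ i) ((φ i).map_source hxs)) contDiffAt_snd) s).continuousAt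
    have h3 : ContinuousAt (fun q : ℝ × M => (q.1, φ i q.2)) (0, x) :=
      continuousAt_fst.prodMk (((φ i).continuousAt hxs).comp_of_eq continuousAt_snd rfl)
    have h4 := ContinuousAt.comp (f := fun q : ℝ × M => (q.1, φ i q.2)) (x := (0, x))
      (h1.sub h2).norm h3
    refine h4.eventually (gt_mem_nhds ?_)
    have h5 := hH i s hs x hx
    rw [← hproj] at h5
    exact h5
  -- Local finiteness leaves only finitely many conditions on t; on the other K i nothing moves.
  have hfin : {i | (K i ∩ C).Nonempty}.Finite := hloc.finite_nonempty_inter_compact hC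
  have hall : ∀ᶠ t in 𝓝 (0 : ℝ), ∀ i ∈ {i | (K i ∩ C).Nonempty}, ∀ s ∈ Set.Iic r, ∀ x ∈ K i,
      ‖iteratedFDeriv ℝ s (fun z => (chartPlane (P t) (φ i) z).starProjection) (φ i x) -
        iteratedFDeriv ℝ s (H₀.chartProj (φ i)) (φ i x)‖ < ε i :=
    (Filter.eventually_all_finite hfin).2 fun i _ =>
      (Filter.eventually_all_finite (Set.finite_Iic r)).2 fun s hs => hnear i s hs
  filter_upwards [hHt, hall] with t ht hall
  refine Set.mem_iInter.2 fun i s hs x hx => ?_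
  have hproj' : (Ht t).chartProj (φ i) =
      fun z => (chartPlane (P t) (φ i) z).starProjection := by
    rw [← ht]
    rfl
  by_cases hi : (K i ∩ C).Nonempty
  · rw [hproj']
    exact hall i hi s hs x hx
  · have hxs := hKφ i hx
    -- C is closed, so off C the two distributions agree on a neighbourhood and all derivatives
    -- coincide.
    have hev : (Ht t).chartProj (φ i) =ᶠ[𝓝 (φ i x)] H.chartProj (φ i) := by
      have h1 : ∀ᶠ z in 𝓝 (φ i x), (φ i).symm z ∈ Cᶜ := by
        refine ((φ i).continuousAt_symm ((φ i).map_source hxs)).eventually ?_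
        rw [(φ i).left_inv hxs]
        exact hC.isClosed.isOpen_compl.eventually_mem fun hxC => hi ⟨x, hx, hxC⟩
      filter_upwards [h1] with z hz
      rw [hproj']
      simp only [chartProj, chartPlane, hPC t _ hz]
    rw [hev.iteratedFDeriv ℝ s |>.self_of_nhds]
    exact hH i s hs x hx

theorem weakTopology_isOpen_chartBall (H : PlaneDistribution n h M)
    (hφ : φ ∈ IsManifold.maximalAtlas (𝓡 n) ∞ M) {K : Set M} (hK : IsCompact K)
    (hKφ : K ⊆ φ.source) (r : ℕ) {ε : ℝ} (hε : 0 < ε) :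
    IsOpen[weakTopology n h M] (H.chartBall φ K r ε) :=
  TopologicalSpace.isOpen_generateFrom_of_mem ⟨H, φ, K, r, ε, hφ, hK, hKφ, hε, rfl⟩

/-- The strong topology is finer than the weak topology. -/
theorem strongTopology_le_weakTopology : strongTopology n h M ≤ weakTopology n h M := by
  refine le_generateFrom ?_
  rintro _ ⟨H, φ, K, r, ε, hφ, hK, hKφ, hε, rfl⟩
  -- A single compact set becomes a locally finite sequence when padded with empty sets.
  refine TopologicalSpace.isOpen_generateFrom_of_mem
    ⟨H, fun _ => φ, fun i => if i = 0 then K else ∅, r, fun _ => ε, fun _ => hφ, fun i => ?_,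
      fun i => ?_, fun x => ⟨Set.univ, Filter.univ_mem, ?_⟩, fun _ => hε, ?_⟩
  · dsimp only
    split_ifs
    exacts [hK, isCompact_empty]
  · dsimp only
    split_ifs
    exacts [hKφ, Set.empty_subset _]
  · refine (Set.finite_singleton 0).subset fun i hi => ?_
    by_contra h0
    have h0' : i ≠ 0 := h0
    simp [h0'] at hi
  · ext H'
    simp only [Set.mem_iInter]
    constructor
    · intro hH' i s hs x hx
      by_cases hi : i = 0
      · exact hH' s hs x (by simpa [hi] using hx)
      · simp [hi] at hx
    · intro hH' s hs x hx
      exact hH' 0 s hs x (by simpa using hx)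

end PlaneDistribution

/-! ### Perturbing a distribution inside a chart. -/

section Perturbation

variable {n h k : ℕ} {M : Type*} [TopologicalSpace M] [ChartedSpace (EuclideanSpace ℝ (Fin n)) M]

/-- The path `θ + t β (θ₁ - θ)` of 1-forms. -/
def perturbedForm {p : ℕ} (β : EuclideanSpace ℝ (Fin n) → ℝ)
    (θ θ₁ : EuclideanSpace ℝ (Fin n) → EuclideanSpace ℝ (Fin n) →L[ℝ] EuclideanSpace ℝ (Fin p))
    (q : ℝ × EuclideanSpace ℝ (Fin n)) :
    EuclideanSpace ℝ (Fin n) →L[ℝ] EuclideanSpace ℝ (Fin p) :=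
  θ q.2 + (q.1 * β q.2) • (θ₁ q.2 - θ q.2)

theorem contDiffOn_perturbedForm {p : ℕ} {β : EuclideanSpace ℝ (Fin n) → ℝ}
    {θ θ₁ : EuclideanSpace ℝ (Fin n) → EuclideanSpace ℝ (Fin n) →L[ℝ] EuclideanSpace ℝ (Fin p)}
    {U : Set (EuclideanSpace ℝ (Fin n))} (hβ : ContDiff ℝ ∞ β) (hθ : ContDiffOn ℝ ∞ θ U)
    (hθ₁ : ContDiffOn ℝ ∞ θ₁ U) :
    ContDiffOn ℝ ∞ (perturbedForm β θ θ₁) (Set.univ ×ˢ U) := by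
  have h1 : Set.MapsTo Prod.snd (Set.univ ×ˢ U : Set (ℝ × EuclideanSpace ℝ (Fin n))) U :=
    fun q hq => hq.2
  have hθ' := hθ.comp contDiffOn_snd h1
  have hθ₁' := hθ₁.comp contDiffOn_snd h1
  exact hθ'.add ((contDiffOn_fst.mul (hβ.comp contDiff_snd).contDiffOn).smul (hθ₁'.sub hθ'))

open Classical in
/-- The plane field equal to the kernel of `perturbedForm` on the subset of the chart `φ`
corresponding to `U`, and to `P` elsewhere. -/
def perturbedPlane {p : ℕ} (P : ∀ x : M, Submodule ℝ (TangentSpace (𝓡 n) x))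
    (φ : OpenPartialHomeomorph M (EuclideanSpace ℝ (Fin n))) (U : Set (EuclideanSpace ℝ (Fin n)))
    (β : EuclideanSpace ℝ (Fin n) → ℝ)
    (θ θ₁ : EuclideanSpace ℝ (Fin n) → EuclideanSpace ℝ (Fin n) →L[ℝ] EuclideanSpace ℝ (Fin p))
    (t : ℝ) (x : M) : Submodule ℝ (TangentSpace (𝓡 n) x) :=
  if x ∈ φ.source ∧ φ x ∈ U then
    (perturbedForm β θ θ₁ (t, φ x)).toLinearMap.ker.comap (chartDeriv φ x).toLinearMap
  else P x

variable {φ : OpenPartialHomeomorph M (EuclideanSpace ℝ (Fin n))}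
  {U L : Set (EuclideanSpace ℝ (Fin n))} {β : EuclideanSpace ℝ (Fin n) → ℝ}

theorem chartPlane_perturbedPlane {p : ℕ} (P : ∀ x : M, Submodule ℝ (TangentSpace (𝓡 n) x))
    {θ θ₁ : EuclideanSpace ℝ (Fin n) → EuclideanSpace ℝ (Fin n) →L[ℝ] EuclideanSpace ℝ (Fin p)}
    (hφ : φ ∈ IsManifold.maximalAtlas (𝓡 n) ∞ M) (hUt : U ⊆ φ.target) (t : ℝ)
    {y : EuclideanSpace ℝ (Fin n)} (hy : y ∈ U) :
    chartPlane (perturbedPlane P φ U β θ θ₁ t) φ y =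
      (perturbedForm β θ θ₁ (t, y)).toLinearMap.ker := by
  obtain ⟨x, hx, rfl⟩ : ∃ x ∈ φ.source, φ x = y :=
    ⟨φ.symm y, φ.map_target (hUt hy), φ.right_inv (hUt hy)⟩
  rw [chartPlane_apply _ hx, perturbedPlane, if_pos ⟨hx, hy⟩]
  exact Submodule.map_comap_eq_of_surjective (bijective_chartDeriv hφ hx).2 _

/-- The two branches of the definition agree wherever t * β = 0; this makes the plane field smooth
across the boundary of U and gives back P at t = 0. -/
theorem perturbedPlane_eq {p : ℕ} (P : ∀ x : M, Submodule ℝ (TangentSpace (𝓡 n) x))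
    {θ θ₁ : EuclideanSpace ℝ (Fin n) → EuclideanSpace ℝ (Fin n) →L[ℝ] EuclideanSpace ℝ (Fin p)}
    (hφ : φ ∈ IsManifold.maximalAtlas (𝓡 n) ∞ M)
    (hker : ∀ y ∈ U, (θ y).toLinearMap.ker = chartPlane P φ y) {t : ℝ} {x : M}
    (hx : t * β (φ x) = 0 ∨ ¬ (x ∈ φ.source ∧ φ x ∈ U)) :
    perturbedPlane P φ U β θ θ₁ t x = P x := by
  by_cases hxU : x ∈ φ.source ∧ φ x ∈ U
  · have h0 : t * β (φ x) = 0 := hx.resolve_right (not_not.2 hxU)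
    rw [perturbedPlane, if_pos hxU]
    ext u
    rw [← mem_chartPlane_iff P hφ hxU.1, ← hker _ hxU.2]
    simp [perturbedForm, h0]
  · rw [perturbedPlane, if_neg hxU]

/-- Off L the form is θ; on the compact set L, surjectivity is an open condition and so holds
uniformly for small t. -/
theorem eventually_surjective_perturbedForm {p : ℕ}
    {θ θ₁ : EuclideanSpace ℝ (Fin n) → EuclideanSpace ℝ (Fin n) →L[ℝ] EuclideanSpace ℝ (Fin p)}
    (hU : IsOpen U) (hβ : ContDiff ℝ ∞ β) (hL : IsCompact L) (hLU : L ⊆ U)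
    (hβL : ∀ y ∉ L, β y = 0) (hθ : ContDiffOn ℝ ∞ θ U) (hθ₁ : ContDiffOn ℝ ∞ θ₁ U)
    (hsurj : ∀ y ∈ U, Function.Surjective (θ y)) :
    ∀ᶠ t in 𝓝 (0 : ℝ), ∀ y ∈ U, Function.Surjective (perturbedForm β θ θ₁ (t, y)) := by
  have h1 : ∀ᶠ t in 𝓝 (0 : ℝ), ∀ y ∈ L,
      Function.Surjective (perturbedForm β θ θ₁ (t, y)) := by
    refine hL.eventually_forall_of_forall_eventually fun y hy => ?_
    have h2 : ContinuousAt (perturbedForm β θ θ₁) ((0 : ℝ), y) :=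
      (contDiffOn_perturbedForm hβ hθ hθ₁).continuousOn.continuousAt
        ((isOpen_univ.prod hU).mem_nhds ⟨trivial, hLU hy⟩)
    refine h2.eventually (isOpen_setOf_clm_surjective.mem_nhds ?_)
    simpa [perturbedForm] using hsurj y (hLU hy)
  filter_upwards [h1] with t ht y hy
  by_cases hyL : y ∈ L
  · exact ht y hyL
  · simpa [perturbedForm, hβL y hyL] using hsurj y hy

end Perturbation

namespace PlaneDistribution

variable {n h k : ℕ} {M : Type*} [TopologicalSpace M] [ChartedSpace (EuclideanSpace ℝ (Fin n)) M]
  [T2Space M] {φ : OpenPartialHomeomorph M (EuclideanSpace ℝ (Fin n))}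
  {U L : Set (EuclideanSpace ℝ (Fin n))} {β : EuclideanSpace ℝ (Fin n) → ℝ}

/-- The perturbation of a distribution along a path of 1-forms supported in a chart. -/
theorem exists_perturbation (H : PlaneDistribution n h M)
    {θ θ₁ : EuclideanSpace ℝ (Fin n) →
      EuclideanSpace ℝ (Fin n) →L[ℝ] EuclideanSpace ℝ (Fin (n - h))}
    (hφ : φ ∈ IsManifold.maximalAtlas (𝓡 n) ∞ M) (hU : IsOpen U) (hUt : U ⊆ φ.target)
    (hβ : ContDiff ℝ ∞ β) (hL : IsCompact L) (hLU : L ⊆ U) (hβL : ∀ y ∉ L, β y = 0)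
    (hθ : ContDiffOn ℝ ∞ θ U) (hθ₁ : ContDiffOn ℝ ∞ θ₁ U)
    (hker : ∀ y ∈ U, Function.Surjective (θ y) ∧
      (θ y).toLinearMap.ker = chartPlane H.plane φ y) :
    ∃ Ht : ℝ → PlaneDistribution n h M,
      Filter.Tendsto Ht (𝓝 0) (@nhds _ (strongTopology n h M) H) ∧
      ∀ᶠ t in 𝓝 (0 : ℝ), ∀ y ∈ U, Function.Surjective (perturbedForm β θ θ₁ (t, y)) ∧
        (perturbedForm β θ θ₁ (t, y)).toLinearMap.ker = chartPlane (Ht t).plane φ y := by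
  set P := perturbedPlane H.plane φ U β θ θ₁ with hPdef
  have hC : IsCompact (φ.symm '' L) :=
    hL.image_of_continuousOn (φ.continuousOn_symm.mono (hLU.trans hUt))
  have hPC : ∀ t, ∀ x ∉ φ.symm '' L, P t x = H.plane x := by
    intro t x hx
    refine perturbedPlane_eq H.plane hφ (fun y hy => (hker y hy).2) ?_
    by_cases hxU : x ∈ φ.source ∧ φ x ∈ U
    · left
      rw [hβL, mul_zero]
      exact fun hL' => hx ⟨φ x, hL', φ.left_inv hxU.1⟩
    · exact Or.inr hxU
  have hP0 : P 0 = H.plane := funext fun x =>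
    perturbedPlane_eq H.plane hφ (fun y hy => (hker y hy).2) (Or.inl (zero_mul _))
  have hform := contDiffOn_perturbedForm hβ hθ hθ₁
  have hev := eventually_surjective_perturbedForm hU hβ hL hLU hβL hθ hθ₁
    fun y hy => (hker y hy).1
  have hnear : ∀ x ∉ φ.symm '' L, ∀ φ' : OpenPartialHomeomorph M (EuclideanSpace ℝ (Fin n)),
      x ∈ φ'.source → ∀ᶠ y in 𝓝 (φ' x), φ'.symm y ∉ φ.symm '' L := by
    intro x hx φ' hx'
    refine (φ'.continuousAt_symm (φ'.map_source hx')).eventually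
      (p := fun z => z ∉ φ.symm '' L) ?_
    rw [φ'.left_inv hx']
    exact hC.isClosed.isOpen_compl.eventually_mem hx
  have hexists : ∀ t, (∀ y ∈ U, Function.Surjective (perturbedForm β θ θ₁ (t, y))) →
      ∃ H' : PlaneDistribution n h M, H'.plane = P t := by
    intro t ht
    -- Over L the perturbed form defines the planes; the complement of the image of L is open, and
    -- there the local forms of H still serve.
    refine ⟨⟨P t, fun x => ?_, fun x => ?_⟩, rfl⟩
    · by_cases hx : x ∈ φ.symm '' L
      · obtain ⟨y, hy, rfl⟩ := hx
        have hyt := hUt (hLU hy)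
        have hbij := bijective_chartDeriv hφ (φ.map_target hyt)
        have h1 := (Submodule.equivMapOfInjective (chartDeriv φ (φ.symm y)).toLinearMap
          hbij.1 (P t (φ.symm y))).finrank_eq
        have h2 := chartPlane_perturbedPlane (β := β) (θ := θ) (θ₁ := θ₁) H.plane hφ hUt t (hLU hy)
        have h3 := LinearMap.finrank_range_add_finrank_ker
          (perturbedForm β θ θ₁ (t, y)).toLinearMap
        rw [LinearMap.range_eq_top.2 (ht y (hLU hy)), finrank_top] at h3
        simp only [finrank_euclideanSpace, Fintype.card_fin] at h3
        have h4 := H.le_dim (φ.symm y)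
        refine h1.trans ?_
        change Module.finrank ℝ (chartPlane (P t) φ y) = h
        rw [hPdef, h2]
        omega
      · rw [hPC t x hx]
        exact H.finrank_plane x
    · by_cases hx : x ∈ φ.symm '' L
      · obtain ⟨y, hy, rfl⟩ := hx
        have hyU := hLU hy
        have hyt := hUt hyU
        refine ⟨φ, fun y => perturbedForm β θ θ₁ (t, y), hφ, φ.map_target hyt, U, hU, ?_, hUt, ?_,
          fun z hz => ⟨ht z hz, (chartPlane_perturbedPlane H.plane hφ hUt t hz).symm⟩⟩
        · rwa [φ.right_inv hyt]
        · exact hform.comp (contDiffOn_const.prodMk contDiffOn_id) fun z hz => ⟨trivial, hz⟩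
      · obtain ⟨φ', θ', hφ', hx', V, hV, hxV, hVt, hθ', hker'⟩ := H.smooth x
        obtain ⟨W, hW, hWo, hxW⟩ := eventually_nhds_iff.1 (hnear x hx φ' hx')
        refine ⟨φ', θ', hφ', hx', V ∩ W, hV.inter hWo, ⟨hxV, hxW⟩, fun z hz => hVt hz.1,
          hθ'.mono Set.inter_subset_left, fun z hz => ⟨(hker' z hz.1).1, ?_⟩⟩
        rw [(hker' z hz.1).2, chartPlane, chartPlane, hPC t _ (hW z hz.2)]
  have : Nonempty (PlaneDistribution n h M) := ⟨H⟩
  -- When the form is not onto everywhere on U, the value of Ht is unspecified; only small t matter.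
  choose! Ht hHt using hexists
  have hHt' : ∀ᶠ t in 𝓝 (0 : ℝ), (Ht t).plane = P t := hev.mono hHt
  refine ⟨Ht, tendsto_strongTopology hP0 hHt' hC hPC fun ψ hψ x hx => ?_, ?_⟩
  · by_cases hxL : x ∈ φ.symm '' L
    · obtain ⟨y, hy, rfl⟩ := hxL
      have hyU := hLU hy
      have hyt := hUt hyU
      have hUn : (Set.univ ×ˢ U : Set (ℝ × EuclideanSpace ℝ (Fin n))) ∈
          𝓝 ((0 : ℝ), φ (φ.symm y)) := by
        rw [φ.right_inv hyt]
        exact (isOpen_univ.prod hU).mem_nhds ⟨trivial, hyU⟩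
      refine contDiffAt_starProjection_chartPlane P hφ hψ (φ.map_target hyt) hx
        (hform.contDiffAt hUn) ?_
      filter_upwards [hUn, hev.prod_inl_nhds (φ (φ.symm y))] with q hq hq'
      exact ⟨hq' _ hq.2, (chartPlane_perturbedPlane H.plane hφ hUt q.1 hq.2).symm⟩
    · obtain ⟨φ', θ', hφ', hx', V, hV, hxV, hVt, hθ', hker'⟩ := H.smooth x
      refine contDiffAt_starProjection_chartPlane P hφ' hψ hx' hx (θ := fun q => θ' q.2)
        (ContDiffAt.comp (g := θ') _ (hθ'.contDiffAt (hV.mem_nhds hxV)) contDiffAt_snd) ?_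
      have h1 := ((hV.eventually_mem hxV).and (hnear x hxL φ' hx')).prod_inr_nhds (0 : ℝ)
      filter_upwards [h1] with q hq
      refine ⟨(hker' _ hq.1).1, ?_⟩
      rw [(hker' _ hq.1).2, chartPlane, chartPlane, hPC _ _ hq.2]
  · filter_upwards [hev, hHt'] with t ht ht' y hy
    refine ⟨ht y hy, ?_⟩
    rw [ht']
    exact (chartPlane_perturbedPlane H.plane hφ hUt t hy).symm

end PlaneDistribution

/-! ### Almost every time is good: analyticity and Fubini. -/

section GenericTime

/-- If the endpoint `g` of the segment from `f` to `g` avoids the zeros of an analytic function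
`Q` everywhere on `B`, then almost every point of the segment avoids them almost everywhere. -/
theorem ae_volume_setOf_analytic_eq_zero {E V : Type*} [NormedAddCommGroup E] [NormedSpace ℝ E]
    [MeasureSpace E] [BorelSpace E] [SecondCountableTopology E]
    [SigmaFinite (volume : Measure E)] [NormedAddCommGroup V] [NormedSpace ℝ V] {f g : E → V}
    {B : Set E} (hB : IsOpen B) (hf : ContinuousOn f B) (hg : ContinuousOn g B) {Q : V → ℝ}
    (hQ : ContDiff ℝ ω Q) (hQg : ∀ y ∈ B, Q (g y) ≠ 0) :
    ∀ᵐ t : ℝ, volume {y ∈ B | Q (f y + t • (g y - f y)) = 0} = 0 := by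
  have hO : IsOpen {q : E × ℝ | q.1 ∈ B ∧ Q (f q.1 + q.2 • (g q.1 - f q.1)) ≠ 0} := by
    have h1 : Set.MapsTo Prod.fst (B ×ˢ Set.univ : Set (E × ℝ)) B := fun q hq => hq.1
    have hf' := hf.comp continuousOn_fst h1
    have hg' := hg.comp continuousOn_fst h1
    have h2 : ContinuousOn (fun q : E × ℝ => Q (f q.1 + q.2 • (g q.1 - f q.1)))
        (B ×ˢ Set.univ) :=
      hQ.continuous.comp_continuousOn (hf'.add (continuousOn_snd.smul (hg'.sub hf')))
    have h3 := h2.isOpen_inter_preimage (hB.prod isOpen_univ) (isOpen_compl_singleton (x := 0))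
    convert h3 using 1
    ext q
    simp
  have hm : MeasurableSet {q : E × ℝ | q.1 ∈ B → Q (f q.1 + q.2 • (g q.1 - f q.1)) ≠ 0} := by
    have h1 : {q : E × ℝ | q.1 ∈ B → Q (f q.1 + q.2 • (g q.1 - f q.1)) ≠ 0} =
        {q : E × ℝ | q.1 ∈ B ∧ Q (f q.1 + q.2 • (g q.1 - f q.1)) ≠ 0} ∪ Prod.fst ⁻¹' Bᶜ := by
      ext q
      by_cases hq : q.1 ∈ B <;> simp [hq]
    rw [h1]
    exact hO.measurableSet.union (measurable_fst hB.measurableSet.compl)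
  have h1 : ∀ᵐ y : E, ∀ᵐ t : ℝ, y ∈ B → Q (f y + t • (g y - f y)) ≠ 0 := by
    refine Filter.Eventually.of_forall fun y => ?_
    by_cases hy : y ∈ B
    -- At t = 1 the argument is g y, so this analytic function of t is not identically zero and its
    -- zeros are discrete.
    · have h2 : AnalyticOnNhd ℝ (fun t : ℝ => Q (f y + t • (g y - f y))) Set.univ :=
        contDiff_omega_iff_analyticOnNhd.1 (hQ.comp (by fun_prop))
      have h3 := h2.preimage_zero_mem_codiscrete (x := 1) (by simpa using hQg y hy)
      have h4 := ae_restrict_le_codiscreteWithin (μ := (volume : Measure ℝ)) MeasurableSet.univ h3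
      rw [Measure.restrict_univ] at h4
      filter_upwards [h4] with t ht _
      exact ht
    · exact Filter.Eventually.of_forall fun t h => absurd h hy
  rw [Measure.ae_ae_comm (p := fun y t => y ∈ B → Q (f y + t • (g y - f y)) ≠ 0) hm] at h1
  filter_upwards [h1] with t ht
  rw [← ht]
  congr 1
  ext y
  simp

end GenericTime

/-- An open set containing the graph of a pair of continuous functions on a compact set contains
a uniform neighbourhood of it. -/
theorem exists_uniform_radius {X Y Z : Type*} [NormedAddCommGroup X] [NormedAddCommGroup Y]
    [NormedAddCommGroup Z] {K : Set X} (hK : IsCompact K) {f : X → Y} {g : X → Z}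
    (hf : ContinuousOn f K) (hg : ContinuousOn g K) {O : Set (X × Y × Z)} (hO : IsOpen O)
    (h : ∀ x ∈ K, (x, f x, g x) ∈ O) :
    ∃ δ > 0, ∀ x ∈ K, ∀ y z, ‖y - f x‖ < δ → ‖z - g x‖ < δ → (x, y, z) ∈ O := by
  have hc : ContinuousOn (fun x => (x, f x, g x)) K := continuousOn_id.prodMk (hf.prodMk hg)
  obtain ⟨δ, hδ, hδs⟩ := (hK.image_of_continuousOn hc).exists_thickening_subset_open hO
    (by rintro _ ⟨x, hx, rfl⟩; exact h x hx)
  refine ⟨δ, hδ, fun x hx y z hy hz => hδs ?_⟩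
  rw [← dist_eq_norm] at hy hz
  rw [Metric.mem_thickening_iff]
  exact ⟨_, ⟨x, hx, rfl⟩, max_lt (by rwa [dist_self]) (max_lt hy hz)⟩

/-! ### Jets of forms and their stability under C¹-small changes. -/

section JetOfForm

variable {E : Type*} [NormedAddCommGroup E] [NormedSpace ℝ E] {p : ℕ}

/-- The 1-jet of a vector valued 1-form. -/
def formJet (θ : E → E →L[ℝ] EuclideanSpace ℝ (Fin p)) (y : E) : FormJet E p :=
  (θ y, fderiv ℝ θ y)

theorem continuousOn_formJet {U : Set E} (hU : IsOpen U)
    {θ : E → E →L[ℝ] EuclideanSpace ℝ (Fin p)} (hθ : ContDiffOn ℝ ∞ θ U) :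
    ContinuousOn (formJet θ) U :=
  hθ.continuousOn.prodMk (hθ.continuousOn_fderiv_of_isOpen hU (by simp))

/-- Where β is locally 1 its derivative contributes nothing, so the jet moves along a segment. -/
theorem formJet_perturbedForm {n : ℕ} {β : EuclideanSpace ℝ (Fin n) → ℝ}
    {θ θ₁ : EuclideanSpace ℝ (Fin n) → EuclideanSpace ℝ (Fin n) →L[ℝ] EuclideanSpace ℝ (Fin p)}
    {y : EuclideanSpace ℝ (Fin n)} (hβ : β =ᶠ[𝓝 y] 1) (hθ : DifferentiableAt ℝ θ y)
    (hθ₁ : DifferentiableAt ℝ θ₁ y) (t : ℝ) :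
    formJet (fun z => perturbedForm β θ θ₁ (t, z)) y =
      formJet θ y + t • (formJet θ₁ y - formJet θ y) := by
  have h1 : (fun z => perturbedForm β θ θ₁ (t, z)) =ᶠ[𝓝 y] θ + t • (θ₁ - θ) := by
    filter_upwards [hβ] with z hz
    simp [perturbedForm, hz]
  refine Prod.ext ?_ ?_
  · simpa [formJet] using h1.self_of_nhds
  · simp only [formJet, Prod.snd_add, Prod.smul_snd, Prod.snd_sub]
    rw [h1.fderiv_eq, fderiv_add hθ ((hθ₁.sub hθ).const_smul t), fderiv_const_smul (hθ₁.sub hθ),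
      fderiv_sub hθ₁ hθ]

/-- The 1-jet at `y` of `θ ∘ (1 - R)` in terms of `y` and the value and derivative of `R` there. -/
def projJet (θ : E → E →L[ℝ] EuclideanSpace ℝ (Fin p)) (q : E × (E →L[ℝ] E) × (E →L[ℝ] E →L[ℝ] E)) :
    FormJet E p :=
  ((θ q.1).comp (ContinuousLinearMap.id ℝ E - q.2.1),
    (ContinuousLinearMap.compL ℝ E E (EuclideanSpace ℝ (Fin p)) (θ q.1)).comp (-q.2.2) +
      ((ContinuousLinearMap.compL ℝ E E (EuclideanSpace ℝ (Fin p))).flip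
        (ContinuousLinearMap.id ℝ E - q.2.1)).comp (fderiv ℝ θ q.1))

/-- This turns C¹-closeness of projections into closeness of jets, with θ kept fixed. -/
theorem formJet_comp_sub {y : E} {θ : E → E →L[ℝ] EuclideanSpace ℝ (Fin p)} {R : E → E →L[ℝ] E}
    (hθ : DifferentiableAt ℝ θ y) (hR : DifferentiableAt ℝ R y) :
    formJet (fun z => (θ z).comp (ContinuousLinearMap.id ℝ E - R z)) y =
      projJet θ (y, R y, fderiv ℝ R y) := by
  refine Prod.ext rfl ?_
  exact (hθ.hasFDerivAt.clm_comp (hR.hasFDerivAt.const_sub _)).fderiv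

theorem continuousOn_projJet {U : Set E} (hU : IsOpen U)
    {θ : E → E →L[ℝ] EuclideanSpace ℝ (Fin p)} (hθ : ContDiffOn ℝ ∞ θ U) :
    ContinuousOn (projJet θ) (U ×ˢ Set.univ) := by
  have h0 : Set.MapsTo Prod.fst
      (U ×ˢ Set.univ : Set (E × (E →L[ℝ] E) × (E →L[ℝ] E →L[ℝ] E))) U := fun q hq => hq.1
  have h1 := hθ.continuousOn.comp continuousOn_fst h0
  have h2 := (hθ.continuousOn_fderiv_of_isOpen hU (by simp)).comp continuousOn_fst h0
  have h3 : Continuous fun q : E × (E →L[ℝ] E) × (E →L[ℝ] E →L[ℝ] E) =>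
      ContinuousLinearMap.id ℝ E - q.2.1 := by fun_prop
  have h4 : Continuous fun q : E × (E →L[ℝ] E) × (E →L[ℝ] E →L[ℝ] E) => -q.2.2 := by fun_prop
  have h5 := (ContinuousLinearMap.compL ℝ E E
    (EuclideanSpace ℝ (Fin p))).continuous.comp_continuousOn h1
  have h6 := ((ContinuousLinearMap.compL ℝ E E
    (EuclideanSpace ℝ (Fin p))).flip.continuous.comp h3).continuousOn (s := U ×ˢ Set.univ)
  have h7 := h5.clm_comp h4.continuousOn
  have h8 := h6.clm_comp h2
  exact (h1.clm_comp h3.continuousOn).prodMk (h7.add h8)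

/-- The non-vanishing of a continuous function on the jets `projJet` is stable, uniformly on
compact sets. -/
theorem exists_projJet_radius {U K : Set E} (hU : IsOpen U)
    {θ : E → E →L[ℝ] EuclideanSpace ℝ (Fin p)} (hθ : ContDiffOn ℝ ∞ θ U) (hK : IsCompact K)
    (hKU : K ⊆ U) {R : E → E →L[ℝ] E} {R' : E → E →L[ℝ] E →L[ℝ] E} (hR : ContinuousOn R K)
    (hR' : ContinuousOn R' K) {Q : FormJet E p → ℝ} (hQ : Continuous Q)
    (h : ∀ y ∈ K, Q (projJet θ (y, R y, R' y)) ≠ 0) :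
    ∃ δ > 0, ∀ y ∈ K, ∀ S S', ‖S - R y‖ < δ → ‖S' - R' y‖ < δ →
      Q (projJet θ (y, S, S')) ≠ 0 := by
  have hc : ContinuousOn (fun q => Q (projJet θ q)) (U ×ˢ Set.univ) :=
    hQ.comp_continuousOn (continuousOn_projJet hU hθ)
  let O : Set (E × (E →L[ℝ] E) × (E →L[ℝ] E →L[ℝ] E)) :=
    {q | q ∈ U ×ˢ Set.univ ∧ Q (projJet θ q) ≠ 0}
  have hO : IsOpen O :=
    hc.isOpen_inter_preimage (hU.prod isOpen_univ) isOpen_compl_singleton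
  have hKO : ∀ y ∈ K, (y, R y, R' y) ∈ O := fun y hy =>
    ⟨Set.mk_mem_prod (hKU hy) (Set.mem_univ _), h y hy⟩
  have hOQ : ∀ q ∈ O, Q (projJet θ q) ≠ 0 := fun q hq => hq.2
  clear_value O
  have hδ := exists_uniform_radius (X := E) (Y := E →L[ℝ] E)
    (Z := E →L[ℝ] E →L[ℝ] E) (f := R) (g := R') (O := O) hK hR hR' hO hKO
  obtain ⟨δ, hδ, hδs⟩ := hδ
  exact ⟨δ, hδ, fun y hy S S' hS hS' => hOQ _ (hδs y hy S S' hS hS')⟩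

end JetOfForm

theorem norm_sub_le_iteratedFDeriv_zero {E V : Type*} [NormedAddCommGroup E] [NormedSpace ℝ E]
    [NormedAddCommGroup V] [NormedSpace ℝ V] (f g : E → V) (y : E) :
    ‖f y - g y‖ ≤ ‖iteratedFDeriv ℝ 0 f y - iteratedFDeriv ℝ 0 g y‖ := by
  have h := (iteratedFDeriv ℝ 0 f y - iteratedFDeriv ℝ 0 g y).le_opNorm 0
  simpa using h

theorem norm_fderiv_sub_le_iteratedFDeriv_one {E V : Type*} [NormedAddCommGroup E]
    [NormedSpace ℝ E] [NormedAddCommGroup V] [NormedSpace ℝ V] (f g : E → V) (y : E) :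
    ‖fderiv ℝ f y - fderiv ℝ g y‖ ≤ ‖iteratedFDeriv ℝ 1 f y - iteratedFDeriv ℝ 1 g y‖ := by
  refine ContinuousLinearMap.opNorm_le_bound _ (norm_nonneg _) fun v => ?_
  have h := (iteratedFDeriv ℝ 1 f y - iteratedFDeriv ℝ 1 g y).le_opNorm fun _ => v
  simpa [iteratedFDeriv_one_apply] using h

/-! ### Openness: a small bad set persists under weak perturbation. -/

namespace PlaneDistribution

variable {n h k : ℕ} {M : Type*} [TopologicalSpace M] [ChartedSpace (EuclideanSpace ℝ (Fin n)) M]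
  {φ : OpenPartialHomeomorph M (EuclideanSpace ℝ (Fin n))}
  {U B : Set (EuclideanSpace ℝ (Fin n))}

/-- The points of `B`, in the chart `φ`, without regular isotropic `k`-plane. -/
def badSet (H : PlaneDistribution n h M) (k : ℕ)
    (φ : OpenPartialHomeomorph M (EuclideanSpace ℝ (Fin n)))
    (B : Set (EuclideanSpace ℝ (Fin n))) : Set (EuclideanSpace ℝ (Fin n)) :=
  {y ∈ B | ¬ H.HasRegularIsotropicPlane k (φ.symm y)}

/-- A form with the kernel of `G` is unchanged by composition with the projection along `G`. -/
theorem formJet_eq_projJet (G : PlaneDistribution n h M)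
    {θ : EuclideanSpace ℝ (Fin n) →
      EuclideanSpace ℝ (Fin n) →L[ℝ] EuclideanSpace ℝ (Fin (n - h))}
    (hφ : φ ∈ IsManifold.maximalAtlas (𝓡 n) ∞ M) (hU : IsOpen U) (hUt : U ⊆ φ.target)
    (hθ : ContDiffOn ℝ ∞ θ U)
    (hker : ∀ y ∈ U, (θ y).toLinearMap.ker = chartPlane G.plane φ y)
    {y : EuclideanSpace ℝ (Fin n)} (hy : y ∈ U) :
    formJet θ y = projJet θ (y, G.chartProj φ y, fderiv ℝ (G.chartProj φ) y) := by
  have h1 : (fun z => (θ z).comp (ContinuousLinearMap.id ℝ _ - G.chartProj φ z)) =ᶠ[𝓝 y] θ := by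
    filter_upwards [hU.mem_nhds hy] with z hz
    ext1 v
    have h2 : G.chartProj φ z v ∈ (θ z).toLinearMap.ker := by
      rw [hker z hz]
      exact Submodule.starProjection_apply_mem _ _
    have h3 : θ z (G.chartProj φ z v) = 0 := h2
    simp [h3]
  rw [← formJet_comp_sub ((hθ.contDiffAt (hU.mem_nhds hy)).differentiableAt (by simp))
    ((G.contDiffAt_chartProj hφ (hUt hy)).differentiableAt (by simp))]
  exact Prod.ext h1.self_of_nhds.symm h1.fderiv_eq.symm

/-- Where a certificate does not vanish for `G`, it gives regular isotropic planes for all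
distributions `C¹`-close to `G`. -/
theorem exists_chartBall_hasRegularIsotropicPlane (G : PlaneDistribution n h M)
    {θ : EuclideanSpace ℝ (Fin n) →
      EuclideanSpace ℝ (Fin n) →L[ℝ] EuclideanSpace ℝ (Fin (n - h))}
    (hφ : φ ∈ IsManifold.maximalAtlas (𝓡 n) ∞ M) (hU : IsOpen U) (hUt : U ⊆ φ.target)
    (hθ : ContDiffOn ℝ ∞ θ U)
    (hker : ∀ y ∈ U, (θ y).toLinearMap.ker = chartPlane G.plane φ y)
    {Q : FormJet (EuclideanSpace ℝ (Fin n)) (n - h) → ℝ} (hQ : IsJetCertificate k Q)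
    {K : Set (EuclideanSpace ℝ (Fin n))} (hK : IsCompact K) (hKU : K ⊆ U)
    (hQK : ∀ y ∈ K, Q (formJet θ y) ≠ 0) :
    ∃ δ > 0, ∀ H ∈ G.chartBall φ (φ.symm '' K) 1 δ, ∀ y ∈ K,
      H.HasRegularIsotropicPlane k (φ.symm y) := by
  have hGsm : ∀ y ∈ K, ContDiffAt ℝ ∞ (G.chartProj φ) y := fun y hy =>
    G.contDiffAt_chartProj hφ (hUt (hKU hy))
  have hc1 : ContinuousOn (G.chartProj φ) K := fun y hy =>
    (hGsm y hy).continuousAt.continuousWithinAt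
  have hc2 : ContinuousOn (fderiv ℝ (G.chartProj φ)) K := fun y hy =>
    ((hGsm y hy).fderiv_right (m := 0) (by simp)).continuousAt.continuousWithinAt
  obtain ⟨δ, hδ, hδs⟩ := exists_projJet_radius hU hθ hK hKU hc1 hc2 hQ.1.continuous
    fun y hy => by
      rw [← G.formJet_eq_projJet hφ hU hUt hθ hker (hKU hy)]
      exact hQK y hy
  refine ⟨δ, hδ, fun H hH y hy => ?_⟩
  have hyt := hUt (hKU hy)
  have hx : φ (φ.symm y) = y := φ.right_inv hyt
  have h0 := hH 0 (by simp) _ ⟨y, hy, rfl⟩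
  have h1 := hH 1 le_rfl _ ⟨y, hy, rfl⟩
  rw [hx] at h0 h1
  have h0' := (norm_sub_le_iteratedFDeriv_zero _ _ _).trans_lt h0
  have h1' := (norm_fderiv_sub_le_iteratedFDeriv_one _ _ _).trans_lt h1
  -- The same θ serves every H near G: θ ∘ (1 - `H.chartProj φ`) kills the planes of H, and
  -- non-vanishing of Q makes it onto, hence a defining form of H.
  have h2 : Q (projJet θ (y, H.chartProj φ y, fderiv ℝ (H.chartProj φ) y)) ≠ 0 :=
    hδs y hy _ _ h0' h1'
  rw [← formJet_comp_sub ((hθ.contDiffAt (hU.mem_nhds (hKU hy))).differentiableAt (by simp))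
    ((H.contDiffAt_chartProj hφ hyt).differentiableAt (by simp))] at h2
  have h4 := hQ.2 _ h2
  rw [← hx] at h4
  exact hasRegularIsotropicPlane_of_jet (H.isLocalDefiningForm_comp_proj hφ
    (φ.map_target hyt) hU (by rw [hx]; exact hKU hy) hUt hθ h4.1) h4

/-- If a certificate vanishes almost nowhere on `B` along `G`, then the distributions near `G`
have few points without regular isotropic planes in `B`. -/
theorem exists_isOpen_volume_badSet_lt (G : PlaneDistribution n h M)
    {θ : EuclideanSpace ℝ (Fin n) →
      EuclideanSpace ℝ (Fin n) →L[ℝ] EuclideanSpace ℝ (Fin (n - h))}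
    (hφ : φ ∈ IsManifold.maximalAtlas (𝓡 n) ∞ M) (hU : IsOpen U) (hUt : U ⊆ φ.target)
    (hB : IsOpen B) (hBU : B ⊆ U) (hBv : volume B ≠ ⊤) (hθ : ContDiffOn ℝ ∞ θ U)
    (hker : ∀ y ∈ U, (θ y).toLinearMap.ker = chartPlane G.plane φ y)
    {Q : FormJet (EuclideanSpace ℝ (Fin n)) (n - h) → ℝ} (hQ : IsJetCertificate k Q)
    (hnull : volume {y ∈ B | Q (formJet θ y) = 0} = 0) {ε : ENNReal} (hε : ε ≠ 0) :
    ∃ V, IsOpen[weakTopology n h M] V ∧ G ∈ V ∧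
      ∀ H ∈ V, volume (badSet H k φ B) < ε := by
  have hO : IsOpen (B ∩ (fun y => Q (formJet θ y)) ⁻¹' {0}ᶜ) :=
    (hQ.1.continuous.comp_continuousOn ((continuousOn_formJet hU hθ).mono
      hBU)).isOpen_inter_preimage hB isOpen_compl_singleton
  set O := B ∩ (fun y => Q (formJet θ y)) ⁻¹' {0}ᶜ with hOdef
  have hOv : volume O ≠ ⊤ := ((measure_mono Set.inter_subset_left).trans_lt hBv.lt_top).ne
  -- Inner regularity: K is compact in the good set O and misses less than ε of it, while B \ O is
  -- null.
  obtain ⟨K, hKO, hK, hKv⟩ := hO.measurableSet.exists_isCompact_sdiff_lt hOv hε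
  have hKU : K ⊆ U := fun y hy => hBU (hKO hy).1
  have hKt : K ⊆ φ.target := hKU.trans hUt
  obtain ⟨δ, hδ, hgood⟩ := G.exists_chartBall_hasRegularIsotropicPlane hφ hU hUt hθ hker hQ hK hKU
    fun y hy => (hKO hy).2
  have hKs : φ.symm '' K ⊆ φ.source := by
    rintro _ ⟨y, hy, rfl⟩
    exact φ.map_target (hKt hy)
  refine ⟨G.chartBall φ (φ.symm '' K) 1 δ, weakTopology_isOpen_chartBall G hφ
    (hK.image_of_continuousOn (φ.continuousOn_symm.mono hKt)) hKs 1 hδ, ?_, fun H hH => ?_⟩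
  · intro s _ x _
    rwa [sub_self, norm_zero]
  calc volume (badSet H k φ B) ≤ volume ({y ∈ B | Q (formJet θ y) = 0} ∪ O \ K) := by
        refine measure_mono fun y hy => ?_
        by_cases hyQ : Q (formJet θ y) = 0
        · exact Or.inl ⟨hy.1, hyQ⟩
        · exact Or.inr ⟨⟨hy.1, hyQ⟩, fun hyK => hy.2 (hgood H hH y hyK)⟩
    _ ≤ 0 + volume (O \ K) := by
        rw [← hnull]
        exact measure_union_le _ _
    _ < ε := by rwa [zero_add]

end PlaneDistribution

/-! ### Density by perturbation, and the countable intersection. -/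

namespace PlaneDistribution

variable {n h k : ℕ} {M : Type*} [TopologicalSpace M] [ChartedSpace (EuclideanSpace ℝ (Fin n)) M]

/-- On a neighbourhood of the closed ball of radius `2r`, in the chart `φ`, the distribution `H` is
the kernel of a 1-form, and there is another 1-form which has regular isotropic `k`-planes on the
ball of radius `r`, as detected by a certificate. -/
def HasModelForm (H : PlaneDistribution n h M) (k : ℕ)
    (φ : OpenPartialHomeomorph M (EuclideanSpace ℝ (Fin n))) (c : EuclideanSpace ℝ (Fin n))
    (r : ℝ) : Prop :=
  ∃ (U : Set (EuclideanSpace ℝ (Fin n))) (θ θ₁ : EuclideanSpace ℝ (Fin n) →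
      EuclideanSpace ℝ (Fin n) →L[ℝ] EuclideanSpace ℝ (Fin (n - h)))
    (Q : FormJet (EuclideanSpace ℝ (Fin n)) (n - h) → ℝ),
    IsOpen U ∧ Metric.closedBall c (2 * r) ⊆ U ∧ U ⊆ φ.target ∧ ContDiffOn ℝ ∞ θ U ∧
    ContDiffOn ℝ ∞ θ₁ U ∧ (∀ y ∈ U, Function.Surjective (θ y) ∧
      (θ y).toLinearMap.ker = chartPlane H.plane φ y) ∧
    IsJetCertificate k Q ∧ ∀ y ∈ Metric.ball c r, Q (formJet θ₁ y) ≠ 0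

/-- Arbitrarily small perturbations of `H` have few points without regular isotropic planes, and so
do the distributions near them. -/
theorem HasModelForm.exists_perturbation [T2Space M] {H : PlaneDistribution n h M}
    {φ : OpenPartialHomeomorph M (EuclideanSpace ℝ (Fin n))}
    (hφ : φ ∈ IsManifold.maximalAtlas (𝓡 n) ∞ M) {c : EuclideanSpace ℝ (Fin n)} {r : ℝ}
    (hr : 0 < r) (hH : H.HasModelForm k φ c r) {W : Set (PlaneDistribution n h M)}
    (hW : IsOpen[strongTopology n h M] W) (hHW : H ∈ W) {ε : ENNReal} (hε : ε ≠ 0) :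
    ∃ G ∈ W, ∃ V, IsOpen[weakTopology n h M] V ∧ G ∈ V ∧
      ∀ H' ∈ V, volume (badSet H' k φ (Metric.ball c r)) < ε := by
  obtain ⟨U, θ, θ₁, Q, hU, hcU, hUt, hθ, hθ₁, hker, hQ, hQθ₁⟩ := hH
  let β : ContDiffBump c := ⟨r, 2 * r, hr, by linarith⟩
  have hBU : Metric.ball c r ⊆ U := (Metric.ball_subset_closedBall.trans
    (Metric.closedBall_subset_closedBall (by linarith))).trans hcU
  obtain ⟨Ht, hHt, hHtker⟩ := H.exists_perturbation hφ hU hUt β.contDiff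
    (isCompact_closedBall c (2 * r)) hcU
    (fun y hy => β.zero_of_le_dist (not_le.1 hy).le) hθ hθ₁ hker
  have hWev : ∀ᶠ t in 𝓝 (0 : ℝ), Ht t ∈ W := by
    let _ := strongTopology n h M
    exact hHt (IsOpen.mem_nhds hW hHW)
  have hae := ae_volume_setOf_analytic_eq_zero Metric.isOpen_ball
    ((continuousOn_formJet hU hθ).mono hBU) ((continuousOn_formJet hU hθ₁).mono hBU) hQ.1 hQθ₁
  -- A conull set of times is dense, so it meets every neighbourhood of 0.
  obtain ⟨t, htv, htW, htker⟩ :=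
    (Measure.dense_of_ae hae).inter_nhds_nonempty (hWev.and hHtker)
  refine ⟨Ht t, htW, ?_⟩
  have hsm : ContDiffOn ℝ ∞ (fun y => perturbedForm β θ θ₁ (t, y)) U :=
    (contDiffOn_perturbedForm β.contDiff hθ hθ₁).comp (contDiffOn_const.prodMk contDiffOn_id)
      fun y hy => ⟨trivial, hy⟩
  refine (Ht t).exists_isOpen_volume_badSet_lt hφ hU hUt Metric.isOpen_ball hBU
    measure_ball_lt_top.ne hsm (fun y hy => (htker y hy).2) hQ ?_ hε
  refine measure_mono_null ?_ htv
  rintro y ⟨hy, hyQ⟩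
  refine ⟨hy, ?_⟩
  have hyU := hU.mem_nhds (hBU hy)
  rwa [formJet_perturbedForm (β.eventuallyEq_one_of_mem_ball hy)
    ((hθ.contDiffAt hyU).differentiableAt (by simp))
    ((hθ₁.contDiffAt hyU).differentiableAt (by simp))] at hyQ

/-- Every point has small neighbourhoods on which a model form exists. -/
theorem exists_hasModelForm (H : PlaneDistribution n h M) (hk : k + (n - h) * k ≤ h)
    {φ : OpenPartialHomeomorph M (EuclideanSpace ℝ (Fin n))}
    (hφ : φ ∈ IsManifold.maximalAtlas (𝓡 n) ∞ M) {x : M} (hx : x ∈ φ.source) :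
    ∃ δ > 0, ∀ r < δ, ∀ c, dist c (φ x) < r → H.HasModelForm k φ c r := by
  have hyt := φ.map_source hx
  have hdim := H.finrank_chartPlane hφ hyt
  have hhn := H.le_dim x
  have hquot : Module.finrank ℝ (EuclideanSpace ℝ (Fin n) ⧸ chartPlane H.plane φ (φ x)) =
      Module.finrank ℝ (EuclideanSpace ℝ (Fin (n - h))) := by
    have h1 := Submodule.finrank_quotient_add_finrank (chartPlane H.plane φ (φ x))
    rw [hdim, finrank_euclideanSpace_fin] at h1
    rw [finrank_euclideanSpace_fin]
    omega
  let L := LinearEquiv.ofFinrankEq _ _ hquot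
  let A : EuclideanSpace ℝ (Fin n) →L[ℝ] EuclideanSpace ℝ (Fin (n - h)) :=
    -- A is the quotient by the plane at x, identified with ℝⁿ⁻ʰ.
    LinearMap.toContinuousLinearMap (L.toLinearMap ∘ₗ (chartPlane H.plane φ (φ x)).mkQ)
  have hA : Function.Surjective A := L.surjective.comp (Submodule.mkQ_surjective _)
  have hAker : A.toLinearMap.ker = chartPlane H.plane φ (φ x) := by
    ext v
    simp [A]
  have hAP : A.comp (ContinuousLinearMap.id ℝ _ - H.chartProj φ (φ x)) = A := by
    ext1 v
    have h2 : H.chartProj φ (φ x) v ∈ A.toLinearMap.ker := by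
      rw [hAker]
      exact Submodule.starProjection_apply_mem _ _
    have h3 : A (H.chartProj φ (φ x) v) = 0 := h2
    simp [h3]
  -- The constant form A has the right kernel only at φ x; composing with the projection along H
  -- corrects it nearby without changing its value at φ x.
  obtain ⟨-, -, U, hU, hxU, hUt, hθ, hker⟩ := H.isLocalDefiningForm_comp_proj hφ hx
    (A := fun _ => A) φ.open_target hyt le_rfl contDiffOn_const (by rw [hAP]; exact hA)
  obtain ⟨D, Q, hQ, hQ0⟩ := exists_certificate (k := k) A hA (by rw [hAker, hdim]; exact hk)
  let θ₁ : EuclideanSpace ℝ (Fin n) →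
      EuclideanSpace ℝ (Fin n) →L[ℝ] EuclideanSpace ℝ (Fin (n - h)) := fun y => A + D (y - φ x)
  have hθ₁ : ContDiff ℝ ∞ θ₁ := by fun_prop
  have hjet : formJet θ₁ (φ x) = (A, D) := by
    refine Prod.ext (by simp [formJet, θ₁]) ?_
    have h1 : HasFDerivAt θ₁ D (φ x) :=
      (D.hasFDerivAt.comp (φ x) ((hasFDerivAt_id (φ x)).sub_const (φ x))).const_add A
    exact h1.fderiv
  have hcont : ContinuousAt (fun y => Q (formJet θ₁ y)) (φ x) :=
    (hQ.1.continuous.comp_continuousOn (continuousOn_formJet isOpen_univ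
      hθ₁.contDiffOn)).continuousAt Filter.univ_mem
  have hev : ∀ᶠ y in 𝓝 (φ x), Q (formJet θ₁ y) ≠ 0 :=
    hcont.eventually_ne (by rw [hjet]; exact hQ0)
  obtain ⟨ρ, hρ, hρs⟩ := Metric.mem_nhds_iff.1 ((hU.eventually_mem hxU).and hev)
  -- A point within 2r of c is within 3r < ρ of φ x.
  refine ⟨ρ / 3, by positivity, fun r hr c hc => ⟨U, _, θ₁, Q, hU, fun y hy => ?_, hUt, hθ,
    hθ₁.contDiffOn, hker, hQ, fun y hy => ?_⟩⟩
  · refine (hρs (Metric.mem_ball.2 ?_)).1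
    have h1 := dist_triangle y c (φ x)
    have h2 := Metric.mem_closedBall.1 hy
    linarith
  · refine (hρs (Metric.mem_ball.2 ?_)).2
    have h1 := dist_triangle y c (φ x)
    have h2 := Metric.mem_ball.1 hy
    have h3 := dist_nonneg (x := c) (y := φ x)
    linarith

/-- Almost everywhere statements can be checked in countably many charts. -/
theorem holdsAlmostEverywhere_of_countable_cover {ι : Type*} [Countable ι] {p : M → Prop}
    (φ : ι → OpenPartialHomeomorph M (EuclideanSpace ℝ (Fin n)))
    (hφ : ∀ i, φ i ∈ IsManifold.maximalAtlas (𝓡 n) ∞ M)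
    (B : ι → Set (EuclideanSpace ℝ (Fin n))) (hB : ∀ i, B i ⊆ (φ i).target)
    (hcover : ∀ x, ∃ i, x ∈ (φ i).symm '' B i)
    (hnull : ∀ i, volume {y ∈ B i | ¬ p ((φ i).symm y)} = 0) : HoldsAlmostEverywhere n p := by
  intro ψ hψ
  have hsub : ψ '' {x ∈ ψ.source | ¬ p x} ⊆ ⋃ i, (fun z => ψ ((φ i).symm z)) ''
      {y | y ∈ B i ∧ ¬ p ((φ i).symm y) ∧ (φ i).symm y ∈ ψ.source} := by
    rintro _ ⟨x, ⟨hx, hxp⟩, rfl⟩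
    obtain ⟨i, y, hy, rfl⟩ := hcover x
    exact Set.mem_iUnion.2 ⟨i, y, ⟨hy, hxp, hx⟩, rfl⟩
  refine measure_mono_null hsub (measure_iUnion_null fun i => ?_)
  have hsub' : {y | y ∈ B i ∧ ¬ p ((φ i).symm y) ∧ (φ i).symm y ∈ ψ.source} ⊆
      {y ∈ B i | ¬ p ((φ i).symm y)} := fun y hy => ⟨hy.1, hy.2.1⟩
  -- Chart transitions are differentiable and so preserve null sets.
  refine addHaar_image_eq_zero_of_differentiableOn_of_addHaar_eq_zero volume (fun y hy => ?_)
    (measure_mono_null hsub' (hnull i))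
  exact ((contDiffAt_chart_transition (hφ i) hψ (hB i hy.1) hy.2.2).differentiableAt
    (by simp)).differentiableWithinAt

/-- Genericity of regular isotropic planes for any topology between the strong and the weak
topologies. -/
theorem residual_holdsAlmostEverywhere [T2Space M] [SecondCountableTopology M]
    [IsManifold (𝓡 n) ∞ M] (hk : k + (n - h) * k ≤ h)
    (τ : TopologicalSpace (PlaneDistribution n h M)) (hτs : strongTopology n h M ≤ τ)
    (hτw : τ ≤ weakTopology n h M) :
    {H : PlaneDistribution n h M | HoldsAlmostEverywhere n
      (fun x : M => H.HasRegularIsotropicPlane k x)} ∈ @residual _ τ := by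
  obtain ⟨s, hs, hsU⟩ := TopologicalSpace.countable_cover_nhds fun x : M =>
    (chartAt (EuclideanSpace ℝ (Fin n)) x).open_source.mem_nhds (mem_chart_source _ x)
  have : Countable s := hs
  have hmax : ∀ x : M, chartAt (EuclideanSpace ℝ (Fin n)) x ∈
      IsManifold.maximalAtlas (𝓡 n) ∞ M := fun x => IsManifold.chart_mem_maximalAtlas x
  let φ : s × ℕ × ℕ → OpenPartialHomeomorph M (EuclideanSpace ℝ (Fin n)) := fun i => chartAt _ i.1.1
  let c : s × ℕ × ℕ → EuclideanSpace ℝ (Fin n) := fun i => TopologicalSpace.denseSeq _ i.2.1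
  let r : s × ℕ × ℕ → ℝ := fun i => 1 / ((i.2.2 : ℝ) + 1)
  have hr : ∀ i, 0 < r i := fun i => by positivity
  let ε : ℕ → ENNReal := fun j => ((j : ENNReal) + 1)⁻¹
  have hε : ∀ j, ε j ≠ 0 := fun j => by simp [ε]
  -- Whether a ball carries a model form depends on H; adding the interior of the set where none
  -- exists makes D dense without discarding any ball.
  let D : (s × ℕ × ℕ) × ℕ → Set (PlaneDistribution n h M) := fun q =>
    interior {H | volume (badSet H k (φ q.1) (Metric.ball (c q.1) (r q.1))) < ε q.2} ∪
      interior {H | ¬ H.HasModelForm k (φ q.1) (c q.1) (r q.1)}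
  have hDopen : ∀ q, IsOpen (D q) := fun q => isOpen_interior.union isOpen_interior
  have hDdense : ∀ q, Dense (D q) := by
    intro q
    rw [dense_iff_inter_open]
    rintro W hW ⟨H, hHW⟩
    -- Either some G in W can be perturbed, or W lies entirely in the second interior. W is open for
    -- the strong topology and V is open for τ, by the two comparisons.
    by_cases hmod : ∃ G ∈ W, G.HasModelForm k (φ q.1) (c q.1) (r q.1)
    · obtain ⟨G, hGW, hG⟩ := hmod
      obtain ⟨G', hG'W, V, hV, hG'V, hVε⟩ := hG.exists_perturbation (hmax _) (hr q.1)
        (hτs W hW) hGW (hε q.2)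
      exact ⟨G', hG'W, Or.inl (mem_interior.2 ⟨V, hVε, hτw V hV, hG'V⟩)⟩
    · refine ⟨H, hHW, Or.inr (mem_interior.2 ⟨W, fun G hGW hG => hmod ⟨G, hGW, hG⟩, hW, hHW⟩)⟩
  have hD : ⋂ q, D q ∈ residual (PlaneDistribution n h M) :=
    countable_iInter_mem.2 fun q => residual_of_dense_open (hDopen q) (hDdense q)
  refine Filter.mem_of_superset hD fun H hH => ?_
  rw [Set.mem_iInter] at hH
  -- Only the balls carrying a model form for H are used. They cover M, and on them H must lie in
  -- the first interior for every j, so the bad sets are null.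
  refine holdsAlmostEverywhere_of_countable_cover
    (ι := {i : s × ℕ × ℕ // H.HasModelForm k (φ i) (c i) (r i)}) (fun i => φ i)
    (fun i => hmax _) (fun i => Metric.ball (c i) (r i)) (fun i => ?_) (fun x => ?_) fun i => ?_
  · obtain ⟨U, -, -, -, -, hcU, hUt, -⟩ := i.2
    exact (Metric.ball_subset_closedBall.trans (Metric.closedBall_subset_closedBall
      (by linarith [hr i.1]))).trans (hcU.trans hUt)
  · have hx : x ∈ ⋃ x ∈ s, (chartAt (EuclideanSpace ℝ (Fin n)) x).source := by
      rw [hsU]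
      trivial
    obtain ⟨x₀, hx₀, hx⟩ := Set.mem_iUnion₂.1 hx
    obtain ⟨δ, hδ, hmod⟩ := H.exists_hasModelForm hk (hmax x₀) hx
    obtain ⟨m, hm⟩ := exists_nat_one_div_lt hδ
    obtain ⟨j, hj⟩ := (TopologicalSpace.denseRange_denseSeq
      (EuclideanSpace ℝ (Fin n))).exists_dist_lt (chartAt (EuclideanSpace ℝ (Fin n)) x₀ x)
      (Nat.one_div_pos_of_nat (α := ℝ) (n := m))
    refine ⟨⟨(⟨x₀, hx₀⟩, j, m), hmod _ hm _ (by rwa [dist_comm])⟩,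
      chartAt (EuclideanSpace ℝ (Fin n)) x₀ x, hj, ?_⟩
    exact OpenPartialHomeomorph.left_inv _ hx
  · by_contra hne
    obtain ⟨j, hj⟩ := ENNReal.exists_inv_nat_lt hne
    rcases hH (i.1, j) with hH' | hH'
    · have h1 : H ∈ {H : PlaneDistribution n h M |
          volume (badSet H k (φ i) (Metric.ball (c i) (r i))) < ε j} := interior_subset hH'
      have h2 : ε j ≤ (j : ENNReal)⁻¹ := ENNReal.inv_le_inv.2 le_self_add
      exact absurd (lt_of_lt_of_le h1 (h2.trans hj.le)) (lt_irrefl _)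
    · have h1 : H ∈ {H : PlaneDistribution n h M | ¬ H.HasModelForm k (φ i) (c i) (r i)} :=
        interior_subset hH'
      exact h1 i.2

end PlaneDistribution

end

theorem mainTheorem9 (n h k : ℕ) (M : Type*) [TopologicalSpace M] [T2Space M]
    [SecondCountableTopology M] [ChartedSpace (EuclideanSpace ℝ (Fin n)) M]
    [IsManifold (𝓡 n) ∞ M] :
    (∀ H : PlaneDistribution n h M, (∃ x : M, H.HasRegularIsotropicPlane k x) →
      (h : ℤ) - k ≥ ((n : ℤ) - h) * k) ∧
    ((h : ℤ) - k ≥ ((n : ℤ) - h) * k →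
      PlaneDistribution.IsGeneric (fun H : PlaneDistribution n h M =>
        HoldsAlmostEverywhere n (fun x : M => H.HasRegularIsotropicPlane k x))) := by
  constructor
  · rintro H ⟨x, hx⟩
    have h1 := hx.dim_le
    -- The bound h ≤ n makes the truncated subtraction n - h agree with the integer one.
    have h2 := H.le_dim x
    zify [h2] at h1
    linarith
  · intro hk
    -- If h > n, a distribution exists only on an empty manifold, and the property holds vacuously.
    by_cases hhn : h ≤ n
    · have hk' : k + (n - h) * k ≤ h := by
        zify [hhn]
        linarith
      exact ⟨PlaneDistribution.residual_holdsAlmostEverywhere hk' _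
          PlaneDistribution.strongTopology_le_weakTopology le_rfl,
        PlaneDistribution.residual_holdsAlmostEverywhere hk' _ le_rfl
          PlaneDistribution.strongTopology_le_weakTopology⟩
    · have huniv : ∀ H : PlaneDistribution n h M, HoldsAlmostEverywhere n
          (fun x : M => H.HasRegularIsotropicPlane k x) := by
        intro H ψ _
        have hempty : {x ∈ ψ.source | ¬ H.HasRegularIsotropicPlane k x} = ∅ :=
          Set.eq_empty_of_forall_notMem fun x _ => hhn (H.le_dim x)
        rw [hempty, Set.image_empty, measure_empty]
      exact ⟨Filter.univ_mem' huniv, Filter.univ_mem' huniv⟩
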